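/- For $x\in(0,1]$ let $T(x)=\frac{1}{\lfloor 1/x\rfloor}\left(\frac1x-\lfloor 1/x\rfloor\right)$, $T(0)=0$, be the Engel continued fraction map, and let $b_n(x)=\lfloor 1/T^{n-1}(x)\rfloor$ ($n\ge 1$) be the partial quotients of the Engel continued fraction expansion of $x$ (these are defined for all $n$ when $x$ is irrational, i.e. for almost every $x$; the values at rational $x$ after the expansion has terminated play no role). Let $\mathbf P$ be Lebesgue measure on the Borel sets of $(0,1]$. Let $p\in(1/2,1)$. Then the sequence $\left\{\frac{\log b_n-n}{n^p}:n\ge1\right\}$ satisfies a moderate deviation principle under $\mathbf P$ with speed $n^{2p-1}$ and good rate function $J(x)=x^2/2$, $x\in\mathbb R$. That is, $J$ is lower semicontinuous with compact sublevel sets, and for every Borel set $\Gamma\subseteq\mathbb R$, $$-\inf_{x\in\Gamma^\circ}\frac{x^2}{2}\le\liminf_{n\to\infty}\frac{1}{n^{2p-1}}\log\mathbf P\left(\frac{\log b_n-n}{n^p}\in\Gamma\right)\le\limsup_{n\to\infty}\frac{1}{n^{2p-1}}\log\mathbf P\left(\frac{\log b_n-n}{n^p}\in\Gamma\right)\le-\inf_{x\in\overline\Gamma}\frac{x^2}{2},$$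 where $\Gamma^\circ$ and $\overline\Gamma$ are the interior and the closure of $\Gamma$, $\log 0=-\infty$ and $\inf\emptyset=+\infty$. -/

import Mathlib

open MeasureTheory Filter Topology Set
open scoped NNReal ENNReal

namespace EngelCF

/-- A good rate function on `ℝ`: a lower semicontinuous function with values in `[0, ∞]` whose
(finite) sublevel sets are compact. -/
structure IsGoodRateFunction (I : ℝ → ℝ≥0∞) : Prop where
  lowerSemicontinuous : LowerSemicontinuous I
  isCompact_sublevel : ∀ α : ℝ≥0, IsCompact {x : ℝ | I x ≤ (α : ℝ≥0∞)}

/-- The sequence `(X n)`, `n ≥ 1`, of real random variables on the probability space `(Ω, P)`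
satisfies a large deviation principle with speed `s n` and good rate function `I`.
Logarithms of probabilities, `liminf`, `limsup` and infima are taken in the extended reals, so that
`log 0 = -∞` and the infimum over the empty set is `+∞`. A moderate deviation principle is formally
the same notion. -/
structure SatisfiesLDP {Ω : Type*} [MeasurableSpace Ω] (P : Measure Ω) (X : ℕ → Ω → ℝ)
    (s : ℕ → ℝ) (I : ℝ → ℝ≥0∞) : Prop where
  isProbabilityMeasure : IsProbabilityMeasure P
  measurable : ∀ n : ℕ, 1 ≤ n → Measurable (X n)
  tendsto_speed : Tendsto s atTop atTop
  good : IsGoodRateFunction I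
  lower_bound : ∀ Γ : Set ℝ, MeasurableSet Γ →
    -(⨅ x ∈ interior Γ, (I x : EReal)) ≤
      liminf (fun n : ℕ => ((1 / s n : ℝ) : EReal) * ENNReal.log (P {ω | X n ω ∈ Γ})) atTop
  upper_bound : ∀ Γ : Set ℝ, MeasurableSet Γ →
    limsup (fun n : ℕ => ((1 / s n : ℝ) : EReal) * ENNReal.log (P {ω | X n ω ∈ Γ})) atTop ≤
      -(⨅ x ∈ closure Γ, (I x : EReal))

/-- The Engel continued fraction map `T x = (1 / [1/x]) * (1/x - [1/x])` for `x ∈ (0,1]`.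
The formula gives `T 0 = 0`, so that an expansion that has terminated stays at `0`. -/
noncomputable def ecfMap (x : ℝ) : ℝ :=
  1 / (⌊1 / x⌋₊ : ℝ) * (1 / x - (⌊1 / x⌋₊ : ℝ))

/-- The `n`-th partial quotient `b n x = [1 / T^(n-1) x]`, `n ≥ 1`, of the Engel continued fraction
expansion of `x ∈ (0,1]`. It has the value `0` once the expansion has terminated, which happens for
rational `x` only; the index `n = 0` is not used. -/
noncomputable def partialQuotient (n : ℕ) (x : ℝ) : ℕ :=
  ⌊1 / (ecfMap^[n - 1] x)⌋₊

/-- Lebesgue measure on `(0,1]`. -/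
noncomputable def lebesgueUnit : Measure ℝ := volume.restrict (Ioc (0 : ℝ) 1)

end EngelCF

namespace EngelCF

/-! Given the first `n` digits, with `b_n = j`, the point `T^n x` has density proportional to `(1 +
y t)⁻²` on `(0, 1/j]` for some `y ∈ [0, 1]` depending on the digits: the change of variables along a
branch of `T` preserves this family (`lintegral_branch`). Hence for `k ≥ j` the conditional
probability of `b_{n+1} ≥ k` is `(j + y) / (k + y)`, which lies between `j / k` and `(j + 1) / (k +
1)`. Up to these bounds `b_{n+1}` behaves like `b_n / U` with `U` uniform and independent, so `log
b_n` behaves like a sum of `n` independent standard exponentials, of mean and variance `n`.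

The tail `gammaTail n` of such a sum satisfies an integral recursion (`lintegral_gammaTail`), and
induction turns the one-step bounds into bounds on the law of `b_n`. From above, `b_n + 1` is
dominated at the cost of a factor `2` (`measure_partialQuotient_add_one_le`). From below, rounding
to an integer costs a factor `1 + 1/N` per step once digits exceed `N`
(`mul_gammaTail_le_measure_partialQuotient`). With `N = n` the total cost is at most `e`. To reach
level `n`, the first `n ^ ((3p - 1)/2)` digits are discarded. This exponent is the midpoint of `2p -
1` and `p`: discarding is invisible at scale `n ^ p`, while failure to reach level `n` is negligible
at speed `n ^ (2p - 1)`.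

Gamma tails are Poisson sums; Chernoff bounds and single terms give both tails the rate `a² / 2`,
and tail rates on half-lines give the full principle (`satisfiesLDP_of_tails`). -/

/-- The integral of `f` over `(0, 1/b]` against the density `(1 + y t)⁻²`. -/
noncomputable def mobiusLintegral (y : ℝ) (b : ℕ) (f : ℝ → ℝ≥0∞) : ℝ≥0∞ :=
  ∫⁻ t in Ioc (0 : ℝ) (1 / b), f t * ENNReal.ofReal (((1 + y * t) ^ 2)⁻¹)

/-! ### Inverse branches of the Engel map and the invariant family of densities -/

theorem floor_one_div_branch {j : ℕ} (hj : 1 ≤ j) {u : ℝ} (hu : u ∈ Ico (0 : ℝ) (1 / j)) :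
    ⌊1 / (1 / (j * (1 + u)) : ℝ)⌋₊ = j := by
  have hj' : (0 : ℝ) < j := by exact_mod_cast hj
  have h1 : (j : ℝ) * u < 1 := by
    have := mul_lt_mul_of_pos_left hu.2 hj'
    rwa [mul_one_div_cancel hj'.ne'] at this
  rw [one_div_one_div, Nat.floor_eq_iff (by have := hu.1; positivity)]
  constructor <;> nlinarith [mul_nonneg hj'.le hu.1]

theorem ecfMap_branch {j : ℕ} (hj : 1 ≤ j) {u : ℝ} (hu : u ∈ Ico (0 : ℝ) (1 / j)) :
    ecfMap (1 / (j * (1 + u))) = u := by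
  have hj' : (0 : ℝ) < j := by exact_mod_cast hj
  rw [ecfMap, floor_one_div_branch hj hu, one_div_one_div]
  field_simp
  ring

theorem image_branch {j : ℕ} (hj : 1 ≤ j) :
    (fun u : ℝ => 1 / (j * (1 + u))) '' Ico (0 : ℝ) (1 / j) =
      Ioc (1 / ((j : ℝ) + 1)) (1 / j) := by
  have hj' : (0 : ℝ) < j := by exact_mod_cast hj
  ext t
  constructor
  · rintro ⟨u, hu, rfl⟩
    have h1 : (j : ℝ) * u < 1 := by
      have := mul_lt_mul_of_pos_left hu.2 hj'
      rwa [mul_one_div_cancel hj'.ne'] at this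
    have h0 := mul_nonneg hj'.le hu.1
    constructor
    · apply one_div_lt_one_div_of_lt <;> nlinarith
    · apply one_div_le_one_div_of_le <;> nlinarith
  · rintro ⟨h1, h2⟩
    have ht : 0 < t := lt_trans (by positivity) h1
    rw [div_lt_iff₀ (by positivity)] at h1
    rw [le_div_iff₀ hj'] at h2
    refine ⟨1 / (j * t) - 1, ⟨?_, ?_⟩, ?_⟩
    · rw [sub_nonneg, le_div_iff₀ (by positivity)]; linarith
    · rw [sub_lt_iff_lt_add, div_lt_iff₀ (by positivity)]
      field_simp
      linarith
    · simp only
      field_simp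
      ring

theorem injOn_branch {j : ℕ} (hj : 1 ≤ j) :
    InjOn (fun u : ℝ => 1 / (j * (1 + u))) (Ico (0 : ℝ) (1 / j)) := fun u hu v hv h => by
  rw [← ecfMap_branch hj hu, ← ecfMap_branch hj hv]
  exact congrArg ecfMap h

/-- Substituting `t = 1 / (j (1 + u))` turns `1 + y t` into `(j + y + j u) / (j (1 + u))`; the
Jacobian cancels the factor `(1 + u)²`, leaving a density of the same family with parameter `j / (j
+ y)`. -/
theorem lintegral_branch {j : ℕ} (hj : 1 ≤ j) {y : ℝ} (hy : 0 ≤ y) (φ : ℕ → ℝ → ℝ≥0∞) :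
    ∫⁻ t in Ioc (1 / ((j : ℝ) + 1)) (1 / j),
        φ ⌊1 / t⌋₊ (ecfMap t) * ENNReal.ofReal (((1 + y * t) ^ 2)⁻¹) =
      ENNReal.ofReal (j / (j + y) ^ 2) * mobiusLintegral (j / (j + y)) j (φ j) := by
  have hj' : (0 : ℝ) < j := by exact_mod_cast hj
  have hd : ∀ u ∈ Ico (0 : ℝ) (1 / j), HasDerivWithinAt (fun u : ℝ => 1 / (j * (1 + u)))
      (-(1 / (j * (1 + u) ^ 2))) (Ico (0 : ℝ) (1 / j)) u := by
    intro u hu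
    have hu0 := hu.1
    have h : HasDerivAt (fun u : ℝ => (j * (1 + u))) ((j : ℝ) * 1) u :=
      ((hasDerivAt_id u).const_add 1).const_mul _
    simp only [one_div]
    refine ((h.fun_inv (by positivity)).congr_deriv ?_).hasDerivWithinAt
    field_simp
  rw [← image_branch hj, lintegral_image_eq_lintegral_abs_deriv_mul measurableSet_Ico hd
    (injOn_branch hj), mobiusLintegral, ← lintegral_const_mul' _ _ ENNReal.ofReal_ne_top,
    -- The branch is parametrised by `[0, 1/j)`, since `u = 0` gives the included endpoint `1/j`;
    -- the integral uses `(0, 1/j]`, which differs by a null set.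
    setLIntegral_congr Ico_ae_eq_Ioc.symm]
  refine setLIntegral_congr_fun measurableSet_Ico fun u hu => ?_
  have hu0 := hu.1
  rw [floor_one_div_branch hj hu, ecfMap_branch hj hu, mul_left_comm,
    mul_left_comm (ENNReal.ofReal _) (φ j u),
    ← ENNReal.ofReal_mul (by positivity), ← ENNReal.ofReal_mul (by positivity), abs_neg,
    abs_of_pos (by positivity)]
  congr 2
  field_simp
  ring

theorem Ioc_zero_one_div_eq_iUnion {b : ℕ} (hb : 1 ≤ b) :
    Ioc (0 : ℝ) (1 / b) =
      ⋃ i : ℕ, Ioc (1 / (((b + i : ℕ) : ℝ) + 1)) (1 / ((b + i : ℕ) : ℝ)) := by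
  have hb' : (0 : ℝ) < b := by exact_mod_cast hb
  ext t
  simp only [mem_iUnion]
  constructor
  · rintro ⟨h0, h1⟩
    have h2 : b ≤ ⌊1 / t⌋₊ := Nat.le_floor (by rwa [le_one_div hb' h0])
    refine ⟨⌊1 / t⌋₊ - b, ?_⟩
    rw [Nat.add_sub_cancel' h2]
    have h3 : (0 : ℝ) < ⌊1 / t⌋₊ := by exact_mod_cast hb.trans h2
    constructor
    · rw [one_div_lt (by positivity) h0]
      exact Nat.lt_floor_add_one _
    · rw [le_one_div h0 h3]
      exact Nat.floor_le (by positivity)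
  · rintro ⟨i, h1, h2⟩
    refine ⟨lt_trans (by positivity) h1, h2.trans ?_⟩
    apply one_div_le_one_div_of_le hb'
    push_cast
    linarith [(Nat.cast_nonneg i : (0 : ℝ) ≤ i)]

theorem pairwise_disjoint_branches (b : ℕ) (hb : 1 ≤ b) : Pairwise (Function.onFun Disjoint
    fun i : ℕ => Ioc (1 / (((b + i : ℕ) : ℝ) + 1)) (1 / ((b + i : ℕ) : ℝ))) := by
  have h : Antitone fun i : ℕ => 1 / ((b + i : ℕ) : ℝ) := by
    intro i k hik
    apply one_div_le_one_div_of_le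
    · exact_mod_cast (by omega : 0 < b + i)
    · exact_mod_cast (by omega : b + i ≤ b + k)
  convert h.pairwise_disjoint_on_Ioc_succ using 4 with i
  simp [add_assoc]

theorem mobiusLintegral_comp_ecfMap {b : ℕ} (hb : 1 ≤ b) {y : ℝ} (hy : 0 ≤ y)
    (φ : ℕ → ℝ → ℝ≥0∞) :
    mobiusLintegral y b (fun t => φ ⌊1 / t⌋₊ (ecfMap t)) =
      ∑' i : ℕ, ENNReal.ofReal (((b + i : ℕ) : ℝ) / (((b + i : ℕ) : ℝ) + y) ^ 2) *
        mobiusLintegral (((b + i : ℕ) : ℝ) / (((b + i : ℕ) : ℝ) + y)) (b + i) (φ (b + i)) := by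
  rw [mobiusLintegral, Ioc_zero_one_div_eq_iUnion hb,
    lintegral_iUnion (fun _ => measurableSet_Ioc) (pairwise_disjoint_branches b hb)]
  exact tsum_congr fun i => lintegral_branch (by omega) hy φ

theorem mobiusLintegral_comp_ecfMap_mono {φ ψ : ℕ → ℝ → ℝ≥0∞}
    (h : ∀ j : ℕ, 1 ≤ j → ∀ y ∈ Icc (0 : ℝ) 1,
      mobiusLintegral y j (φ j) ≤ mobiusLintegral y j (ψ j))
    {b : ℕ} (hb : 1 ≤ b) {y : ℝ} (hy : y ∈ Icc (0 : ℝ) 1) :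
    mobiusLintegral y b (fun t => φ ⌊1 / t⌋₊ (ecfMap t)) ≤
      mobiusLintegral y b (fun t => ψ ⌊1 / t⌋₊ (ecfMap t)) := by
  rw [mobiusLintegral_comp_ecfMap hb hy.1, mobiusLintegral_comp_ecfMap hb hy.1]
  refine ENNReal.tsum_le_tsum fun i => ?_
  have h0 : (0 : ℝ) < ((b + i : ℕ) : ℝ) := by exact_mod_cast (by omega : 0 < b + i)
  have hy0 := hy.1
  gcongr
  refine h _ (by omega) _ ⟨by positivity, ?_⟩
  rw [div_le_one (by positivity)]
  linarith

/-- A comparison valid for every digit `j` and every `y ∈ [0, 1]` survives conditioning on any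
number of earlier digits, because the law of an iterate is a mixture of densities in the family.
One-step estimates therefore suffice. -/
theorem mobiusLintegral_iterate_mono {φ ψ : ℕ → ℝ → ℝ≥0∞}
    (h : ∀ j : ℕ, 1 ≤ j → ∀ y ∈ Icc (0 : ℝ) 1,
      mobiusLintegral y j (φ j) ≤ mobiusLintegral y j (ψ j)) (m : ℕ) :
    ∀ b : ℕ, 1 ≤ b → ∀ y ∈ Icc (0 : ℝ) 1,
      mobiusLintegral y b (fun t => φ ⌊1 / (ecfMap^[m] t)⌋₊ (ecfMap^[m + 1] t)) ≤
        mobiusLintegral y b (fun t => ψ ⌊1 / (ecfMap^[m] t)⌋₊ (ecfMap^[m + 1] t)) := by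
  induction m with
  | zero => exact fun b hb y hy => mobiusLintegral_comp_ecfMap_mono h hb hy
  | succ m ih =>
    intro b hb y hy
    exact mobiusLintegral_comp_ecfMap_mono
      (φ := fun _ t => φ ⌊1 / (ecfMap^[m] t)⌋₊ (ecfMap^[m + 1] t))
      (ψ := fun _ t => ψ ⌊1 / (ecfMap^[m] t)⌋₊ (ecfMap^[m + 1] t)) ih hb hy

/-! ### One-step tail probabilities of the digits -/

theorem lintegral_mobius_density {y s : ℝ} (hy : 0 ≤ y) (hs : 0 ≤ s) :
    ∫⁻ t in Ioc (0 : ℝ) s, ENNReal.ofReal (((1 + y * t) ^ 2)⁻¹) =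
      ENNReal.ofReal (s / (1 + y * s)) := by
  have hpos : ∀ t ∈ uIcc 0 s, 0 < 1 + y * t := by
    intro t ht
    rw [uIcc_of_le hs] at ht
    have := mul_nonneg hy ht.1
    linarith
  have hc : ContinuousOn (fun t : ℝ => ((1 + y * t) ^ 2)⁻¹) (uIcc 0 s) :=
    ContinuousOn.inv₀ (by fun_prop) fun t ht => (pow_pos (hpos t ht) 2).ne'
  have hi : IntervalIntegrable (fun t : ℝ => ((1 + y * t) ^ 2)⁻¹) volume 0 s :=
    hc.intervalIntegrable
  rw [← ofReal_integral_eq_lintegral_ofReal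
    ((intervalIntegrable_iff_integrableOn_Ioc_of_le hs).1 hi)
    (ae_of_all _ fun t => by positivity), ← intervalIntegral.integral_of_le hs]
  congr 1
  rw [intervalIntegral.integral_eq_sub_of_hasDerivAt (f := fun t => t / (1 + y * t)) _ hi]
  · simp
  · intro t ht
    have h := hpos t ht
    have h1 : HasDerivAt (fun t : ℝ => 1 + y * t) (y * 1) t :=
      ((hasDerivAt_id t).const_mul y).const_add 1
    refine ((hasDerivAt_id' t).fun_div h1 h.ne').congr_deriv ?_
    field_simp
    ring

theorem mobiusLintegral_const {b : ℕ} (hb : 1 ≤ b) {y : ℝ} (hy : 0 ≤ y) (c : ℝ≥0∞) :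
    mobiusLintegral y b (fun _ => c) = c * ENNReal.ofReal (1 / (b + y)) := by
  have hb' : (0 : ℝ) < b := by exact_mod_cast hb
  rw [mobiusLintegral, lintegral_const_mul _ (by fun_prop), lintegral_mobius_density hy (by positivity)]
  congr 2
  field_simp

theorem mobiusLintegral_floor_ge {b k : ℕ} (hb : 1 ≤ b) (hk : 1 ≤ k) {y : ℝ} (hy : 0 ≤ y) :
    mobiusLintegral y b (fun t => if k ≤ ⌊1 / t⌋₊ then 1 else 0) =
      ENNReal.ofReal (1 / ((max k b : ℕ) + y)) := by
  have hb' : (0 : ℝ) < b := by exact_mod_cast hb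
  have hk' : (0 : ℝ) < k := by exact_mod_cast hk
  have hm : 1 ≤ max k b := le_max_of_le_left hk
  rw [← one_mul (ENNReal.ofReal _), ← mobiusLintegral_const hm hy, mobiusLintegral, mobiusLintegral]
  have hsub : Ioc (0 : ℝ) (1 / (max k b : ℕ)) ⊆ Ioc (0 : ℝ) (1 / b) := by
    refine Ioc_subset_Ioc_right (one_div_le_one_div_of_le hb' ?_)
    exact_mod_cast le_max_right k b
  rw [← inter_eq_right.2 hsub, inter_comm, ← setLIntegral_indicator measurableSet_Ioc]
  refine setLIntegral_congr_fun measurableSet_Ioc fun t ht => ?_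
  have : k ≤ ⌊1 / t⌋₊ ↔ t ∈ Ioc (0 : ℝ) (1 / (max k b : ℕ)) := by
    rw [Nat.le_floor_iff (one_div_nonneg.2 ht.1.le), mem_Ioc,
      le_one_div ht.1 (Nat.cast_pos.2 hm), Nat.cast_max, max_le_iff, le_one_div hb' ht.1]
    exact ⟨fun h => ⟨ht.1, h, ht.2⟩, fun h => h.2.1⟩
  by_cases h : k ≤ ⌊1 / t⌋₊
  · simp only [h, if_true, indicator_of_mem (this.1 h)]
  · simp only [h, if_false, zero_mul, indicator_of_notMem (fun h' => h (this.2 h'))]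

/-- For `k ≥ j` the exact conditional probability `(j + y) / (k + y)` increases with `y`; the
extreme `y = 1` gives this upper bound, and `y = 0` gives the lower bound in the companion lemma. -/
theorem floor_ge_le_mobiusLintegral {k : ℕ} (hk : 1 ≤ k) (j : ℕ) (hj : 1 ≤ j) (y : ℝ)
    (hy : y ∈ Icc (0 : ℝ) 1) :
    mobiusLintegral y j (fun t => if k ≤ ⌊1 / t⌋₊ then 1 else 0) ≤
      mobiusLintegral y j (fun _ => ENNReal.ofReal (min 1 (((j : ℝ) + 1) / (k + 1)))) := by
  have hj' : (0 : ℝ) < j := by exact_mod_cast hj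
  have hk' : (0 : ℝ) < k := by exact_mod_cast hk
  obtain ⟨hy0, hy1⟩ := hy
  rw [mobiusLintegral_floor_ge hj hk hy0, mobiusLintegral_const hj hy0,
    ← ENNReal.ofReal_mul (by positivity)]
  apply ENNReal.ofReal_le_ofReal
  rcases le_total k j with h | h
  · have h' : (k : ℝ) ≤ j := by exact_mod_cast h
    rw [max_eq_right h, min_eq_left, one_mul]
    rw [le_div_iff₀ (by positivity)]; linarith
  · have h' : (j : ℝ) ≤ k := by exact_mod_cast h
    rw [max_eq_left h, min_eq_right, div_mul_div_comm, div_le_div_iff₀ (by positivity) (by positivity)]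
    · nlinarith
    · rw [div_le_iff₀ (by positivity)]; linarith

theorem mobiusLintegral_le_floor_ge {k : ℕ} (hk : 1 ≤ k) (j : ℕ) (hj : 1 ≤ j) (y : ℝ)
    (hy : y ∈ Icc (0 : ℝ) 1) :
    mobiusLintegral y j (fun _ => ENNReal.ofReal (min 1 ((j : ℝ) / k))) ≤
      mobiusLintegral y j (fun t => if k ≤ ⌊1 / t⌋₊ then 1 else 0) := by
  have hj' : (0 : ℝ) < j := by exact_mod_cast hj
  have hk' : (0 : ℝ) < k := by exact_mod_cast hk
  obtain ⟨hy0, hy1⟩ := hy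
  rw [mobiusLintegral_floor_ge hj hk hy0, mobiusLintegral_const hj hy0,
    ← ENNReal.ofReal_mul (by positivity)]
  apply ENNReal.ofReal_le_ofReal
  rcases le_total k j with h | h
  · have h' : (k : ℝ) ≤ j := by exact_mod_cast h
    rw [max_eq_right h, min_eq_left, one_mul]
    rw [le_div_iff₀ (by positivity)]; linarith
  · have h' : (j : ℝ) ≤ k := by exact_mod_cast h
    rw [max_eq_left h, min_eq_right, div_mul_div_comm, div_le_div_iff₀ (by positivity) (by positivity)]
    · nlinarith
    · rw [div_le_iff₀ (by positivity)]; linarith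

/-! ### Measurability and transfer to Lebesgue measure -/

theorem measurable_ecfMap : Measurable ecfMap := by
  unfold ecfMap
  have h : Measurable fun x : ℝ => ((⌊1 / x⌋₊ : ℕ) : ℝ) :=
    measurable_from_nat.comp (Nat.measurable_floor.comp (measurable_const.div measurable_id))
  exact (measurable_const.div h).mul ((measurable_const.div measurable_id).sub h)

theorem measurable_partialQuotient (n : ℕ) : Measurable (partialQuotient n) := by
  unfold partialQuotient
  exact Nat.measurable_floor.comp (measurable_const.div (measurable_ecfMap.iterate _))

instance : IsProbabilityMeasure lebesgueUnit := ⟨by simp [lebesgueUnit]⟩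

theorem mobiusLintegral_zero_one (f : ℝ → ℝ≥0∞) :
    mobiusLintegral 0 1 f = ∫⁻ x, f x ∂lebesgueUnit := by
  simp [mobiusLintegral, lebesgueUnit]

theorem lintegral_partialQuotient_ge (n k : ℕ) :
    ∫⁻ x, (if k ≤ partialQuotient n x then 1 else 0) ∂lebesgueUnit =
      lebesgueUnit {x | k ≤ partialQuotient n x} := by
  have h : MeasurableSet {x | k ≤ partialQuotient n x} :=
    measurable_partialQuotient n measurableSet_Ici
  rw [← lintegral_indicator_one h]
  exact lintegral_congr fun x => by simp [indicator_apply]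

theorem measure_partialQuotient_succ_le {n k : ℕ} (hn : 1 ≤ n) (hk : 1 ≤ k) :
    lebesgueUnit {x | k ≤ partialQuotient (n + 1) x} ≤
      ∫⁻ x, ENNReal.ofReal (min 1 (((partialQuotient n x : ℝ) + 1) / (k + 1))) ∂lebesgueUnit := by
  obtain ⟨m, rfl⟩ := Nat.exists_eq_add_of_le' hn
  rw [← lintegral_partialQuotient_ge, ← mobiusLintegral_zero_one, ← mobiusLintegral_zero_one]
  exact mobiusLintegral_iterate_mono (floor_ge_le_mobiusLintegral hk) m 1 le_rfl 0 (by simp)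

theorem le_measure_partialQuotient_succ {n k : ℕ} (hn : 1 ≤ n) (hk : 1 ≤ k) :
    ∫⁻ x, ENNReal.ofReal (min 1 ((partialQuotient n x : ℝ) / k)) ∂lebesgueUnit ≤
      lebesgueUnit {x | k ≤ partialQuotient (n + 1) x} := by
  obtain ⟨m, rfl⟩ := Nat.exists_eq_add_of_le' hn
  rw [← lintegral_partialQuotient_ge, ← mobiusLintegral_zero_one, ← mobiusLintegral_zero_one]
  exact mobiusLintegral_iterate_mono (mobiusLintegral_le_floor_ge hk) m 1 le_rfl 0 (by simp)

theorem measure_partialQuotient_one {k : ℕ} (hk : 1 ≤ k) :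
    lebesgueUnit {x | k ≤ partialQuotient 1 x} = ENNReal.ofReal (1 / k) := by
  rw [← lintegral_partialQuotient_ge, ← mobiusLintegral_zero_one]
  refine (mobiusLintegral_floor_ge le_rfl hk le_rfl).trans ?_
  simp [hk]

/-! ### Gamma tails: recursion, Chernoff bounds, single-term bounds -/

/-- The tail `r ↦ ℙ (exp S ≥ r)`, where `S` is a sum of `n` independent standard exponential random
variables. -/
noncomputable def gammaTail (n : ℕ) (r : ℝ) : ℝ :=
  if r ≤ 1 then 1 else r⁻¹ * ∑ k ∈ Finset.range n, Real.log r ^ k / (k.factorial : ℝ)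

theorem gammaTail_of_le_one {n : ℕ} {r : ℝ} (hr : r ≤ 1) : gammaTail n r = 1 := if_pos hr

theorem gammaTail_of_one_lt {n : ℕ} {r : ℝ} (hr : 1 < r) :
    gammaTail n r = r⁻¹ * ∑ k ∈ Finset.range n, Real.log r ^ k / (k.factorial : ℝ) :=
  if_neg hr.not_ge

theorem gammaTail_nonneg (n : ℕ) (r : ℝ) : 0 ≤ gammaTail n r := by
  rcases le_or_gt r 1 with hr | hr
  · simp [gammaTail_of_le_one hr]
  · rw [gammaTail_of_one_lt hr]
    have := Real.log_nonneg hr.le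
    positivity

theorem gammaTail_le_one (n : ℕ) (r : ℝ) : gammaTail n r ≤ 1 := by
  rcases le_or_gt r 1 with hr | hr
  · simp [gammaTail_of_le_one hr]
  · rw [gammaTail_of_one_lt hr, inv_mul_le_iff₀ (by linarith), mul_one]
    exact (Real.sum_le_exp_of_nonneg (Real.log_nonneg hr.le) n).trans
      (Real.exp_log (by linarith)).le

theorem gammaTail_exp {n : ℕ} {s : ℝ} (hs : 0 < s) :
    gammaTail n (Real.exp s) =
      Real.exp (-s) * ∑ k ∈ Finset.range n, s ^ k / (k.factorial : ℝ) := by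
  rw [gammaTail_of_one_lt (by simpa using hs), Real.log_exp, Real.exp_neg]

theorem gammaTail_succ_of_one_lt {n : ℕ} {r : ℝ} (hr : 1 < r) :
    gammaTail (n + 1) r =
      r⁻¹ + r⁻¹ * ∑ k ∈ Finset.range n, Real.log r ^ (k + 1) / ((k + 1).factorial : ℝ) := by
  rw [gammaTail_of_one_lt hr, Finset.sum_range_succ']
  simp
  ring

/-- Conditioning on the last exponential, written `-log u` with `u` uniform on `(0, 1]`, leaves `n`
variables that must exceed the level `u r`. -/
theorem lintegral_gammaTail (n : ℕ) (r : ℝ) :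
    ∫⁻ u in Ioc (0 : ℝ) 1, ENNReal.ofReal (gammaTail n (u * r)) =
      ENNReal.ofReal (gammaTail (n + 1) r) := by
  rcases le_or_gt r 1 with hr | hr
  · rw [gammaTail_of_le_one hr, setLIntegral_congr_fun (g := fun _ => 1) measurableSet_Ioc]
    · simp
    · intro u hu
      have : u * r ≤ 1 := by nlinarith [hu.1, hu.2]
      simp [gammaTail_of_le_one this]
  have hr0 : 0 < r := by linarith
  have hri : r⁻¹ ≤ 1 := inv_le_one_of_one_le₀ hr.le
  have hlog := Real.log_nonneg hr.le
  -- The integral splits at `u = r⁻¹`: below it the tail equals `1` and contributes the `k = 0` term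
  -- `r⁻¹`; above it the antiderivative raises each power of the logarithm by one.
  rw [gammaTail_succ_of_one_lt hr, ENNReal.ofReal_add (by positivity) (by positivity),
    ← Ioc_union_Ioc_eq_Ioc (inv_nonneg.2 hr0.le) hri,
    lintegral_union measurableSet_Ioc (Ioc_disjoint_Ioc_of_le le_rfl)]
  congr 1
  · rw [setLIntegral_congr_fun (g := fun _ => 1) measurableSet_Ioc]
    · simp
    · intro u hu
      have : u * r ≤ 1 := by
        have := mul_le_mul_of_nonneg_right hu.2 hr0.le
        rwa [inv_mul_cancel₀ hr0.ne'] at this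
      simp [gammaTail_of_le_one this]
  · have hone : ∀ u ∈ Icc r⁻¹ 1, 1 ≤ u * r := fun u hu => by
      have := mul_le_mul_of_nonneg_right hu.1 hr0.le
      rwa [inv_mul_cancel₀ hr0.ne'] at this
    have hu0 : ∀ u ∈ uIcc r⁻¹ 1, 0 < u := fun u hu => by
      rw [uIcc_of_le hri] at hu
      exact lt_of_lt_of_le (by positivity) hu.1
    have hc : ContinuousOn (fun u : ℝ => (u * r)⁻¹ *
        ∑ k ∈ Finset.range n, Real.log (u * r) ^ k / (k.factorial : ℝ)) (uIcc r⁻¹ 1) := by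
      have hne : ∀ u ∈ uIcc r⁻¹ 1, u * r ≠ 0 := fun u hu => (mul_pos (hu0 u hu) hr0).ne'
      have h1 : ContinuousOn (fun u : ℝ => u * r) (uIcc r⁻¹ 1) := by fun_prop
      refine (h1.inv₀ hne).mul (continuousOn_finsetSum _ fun k _ => ?_)
      exact ((h1.log hne).pow k).div_const _
    have hi := hc.intervalIntegrable (μ := volume)
    have hpos : ∀ u ∈ Ioc r⁻¹ 1, 0 ≤ (u * r)⁻¹ *
        ∑ k ∈ Finset.range n, Real.log (u * r) ^ k / (k.factorial : ℝ) := fun u hu => by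
      have h := hone u ⟨hu.1.le, hu.2⟩
      have := Real.log_nonneg h
      positivity
    have hset : ∀ u ∈ Ioc r⁻¹ 1, gammaTail n (u * r) = (u * r)⁻¹ *
        ∑ k ∈ Finset.range n, Real.log (u * r) ^ k / (k.factorial : ℝ) := fun u hu => by
      refine gammaTail_of_one_lt ?_
      have := mul_lt_mul_of_pos_right hu.1 hr0
      rwa [inv_mul_cancel₀ hr0.ne'] at this
    rw [setLIntegral_congr_fun measurableSet_Ioc
      (fun u hu => congrArg ENNReal.ofReal (hset u hu)),
      ← ofReal_integral_eq_lintegral_ofReal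
      ((intervalIntegrable_iff_integrableOn_Ioc_of_le hri).1 hi)
      ((ae_restrict_iff' measurableSet_Ioc).2 (ae_of_all _ hpos)),
      ← intervalIntegral.integral_of_le hri]
    congr 1
    rw [intervalIntegral.integral_eq_sub_of_hasDerivAt (f := fun u => r⁻¹ *
      ∑ k ∈ Finset.range n, Real.log (u * r) ^ (k + 1) / ((k + 1).factorial : ℝ)) _ hi]
    · simp [hr0.ne']
    · intro u hu
      have hu' := hu0 u hu
      have hl : HasDerivAt (fun u => Real.log (u * r)) (1 * r / (u * r)) u :=
        ((hasDerivAt_id' u).mul_const r).log (by positivity)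
      refine ((HasDerivAt.fun_sum fun k _ => (hl.fun_pow (k + 1)).div_const _).const_mul _).congr_deriv ?_
      rw [mul_inv, mul_comm u⁻¹, mul_assoc, Finset.mul_sum, Finset.mul_sum, Finset.mul_sum]
      refine Finset.sum_congr rfl fun k _ => ?_
      rw [Nat.factorial_succ]
      push_cast
      field_simp

theorem antitone_gammaTail (n : ℕ) : Antitone (gammaTail n) := by
  induction n with
  | zero =>
    intro r s h
    unfold gammaTail
    split_ifs <;> simp
    linarith
  | succ n ih =>
    intro r s h
    rw [← ENNReal.ofReal_le_ofReal_iff (gammaTail_nonneg _ _), ← lintegral_gammaTail,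
      ← lintegral_gammaTail]
    refine setLIntegral_mono' measurableSet_Ioc fun u hu => ?_
    exact ENNReal.ofReal_le_ofReal (ih (mul_le_mul_of_nonneg_left h hu.1.le))

/-- Chernoff bound in Poisson form: for `x ≤ 1` each term with `k < n` grows when multiplied by `x ^
k / x ^ n`, and completing the series gives `exp (s x)`. The complementary bound takes `x ≥ 1`, and
both are later optimised at `x = n / s`. -/
theorem gammaTail_exp_le {n : ℕ} {s x : ℝ} (hs : 0 < s) (hx : 0 < x) (hx1 : x ≤ 1) :
    gammaTail n (Real.exp s) ≤ Real.exp (s * x - s) / x ^ n := by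
  rw [gammaTail_exp hs, sub_eq_neg_add, Real.exp_add, mul_div_assoc]
  gcongr
  rw [le_div_iff₀ (by positivity), Finset.sum_mul]
  refine le_trans (Finset.sum_le_sum fun k hk => ?_) (Real.sum_le_exp_of_nonneg (by positivity) n)
  have h : x ^ n ≤ x ^ k := pow_le_pow_of_le_one hx.le hx1 (Finset.mem_range.1 hk).le
  rw [mul_pow, div_mul_eq_mul_div]
  gcongr

theorem one_sub_gammaTail_exp {n : ℕ} {s : ℝ} (hs : 0 < s) :
    HasSum (fun k : ℕ => Real.exp (-s) * (s ^ (k + n) / ((k + n).factorial : ℝ)))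
      (1 - gammaTail n (Real.exp s)) := by
  have h := NormedSpace.expSeries_div_hasSum_exp (𝔸 := ℝ) s
  rw [← Real.exp_eq_exp_ℝ] at h
  have h2 := ((hasSum_nat_add_iff' n).2 h).mul_left (Real.exp (-s))
  rwa [mul_sub, ← gammaTail_exp hs, ← Real.exp_add, neg_add_cancel, Real.exp_zero] at h2

theorem one_sub_gammaTail_exp_le {n : ℕ} {s x : ℝ} (hs : 0 < s) (hx1 : 1 ≤ x) :
    1 - gammaTail n (Real.exp s) ≤ Real.exp (s * x - s) / x ^ n := by
  have hx : 0 < x := by linarith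
  have h := NormedSpace.expSeries_div_hasSum_exp (𝔸 := ℝ) (s * x)
  rw [← Real.exp_eq_exp_ℝ] at h
  have h2 := ((hasSum_nat_add_iff' n).2 h).mul_left (Real.exp (-s) / x ^ n)
  refine (hasSum_le (fun k => ?_) (one_sub_gammaTail_exp hs) h2).trans ?_
  · have h3 : (1 : ℝ) ≤ x ^ k := one_le_pow₀ hx1
    rw [mul_pow, pow_add x, div_mul_eq_mul_div]
    rw [le_div_iff₀ (by positivity)]
    calc Real.exp (-s) * (s ^ (k + n) / ((k + n).factorial : ℝ)) * x ^ n
        = Real.exp (-s) * (s ^ (k + n) * (1 * x ^ n) / ((k + n).factorial : ℝ)) := by ring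
      _ ≤ _ := by gcongr
  · rw [sub_eq_neg_add (s * x) s, Real.exp_add, mul_div_right_comm]
    gcongr
    have : 0 ≤ ∑ k ∈ Finset.range n, (s * x) ^ k / (k.factorial : ℝ) := by positivity
    linarith

theorem le_gammaTail_exp {n : ℕ} (hn : 1 ≤ n) {s : ℝ} (hs : 0 < s) :
    Real.exp (-s) * (s ^ (n - 1) / ((n - 1).factorial : ℝ)) ≤ gammaTail n (Real.exp s) := by
  rw [gammaTail_exp hs]
  gcongr
  have h : n - 1 ∈ Finset.range n := Finset.mem_range.2 (by omega)
  exact Finset.single_le_sum (f := fun k => s ^ k / (k.factorial : ℝ))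
    (fun k _ => by positivity) h

theorem le_one_sub_gammaTail_exp {n : ℕ} {s : ℝ} (hs : 0 < s) :
    Real.exp (-s) * (s ^ n / (n.factorial : ℝ)) ≤ 1 - gammaTail n (Real.exp s) := by
  have h := le_hasSum (one_sub_gammaTail_exp (n := n) hs) 0 fun k _ => by positivity
  simpa using h

/-! ### Comparison of the digits with Gamma tails -/

/-- `min 1 (X / K)` is the probability that a uniform `u` satisfies `u K ≤ X`. This puts the
one-step bounds in the form of the recursion for `gammaTail`. -/
theorem lintegral_min_one_div {Ω : Type*} [MeasurableSpace Ω] {P : Measure Ω} {X : Ω → ℝ}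
    (hX : Measurable X) (hX0 : ∀ ω, 0 ≤ X ω) {K : ℝ} (hK : 0 < K) :
    ∫⁻ ω, ENNReal.ofReal (min 1 (X ω / K)) ∂P = ∫⁻ u in Ioc (0 : ℝ) 1, P {ω | u * K ≤ X ω} := by
  have h0 : ∀ ω, 0 ≤ min 1 (X ω / K) := fun ω => by have := hX0 ω; positivity
  rw [lintegral_eq_lintegral_meas_le P (ae_of_all _ h0) (by fun_prop),
    ← Ioc_union_Ioi_eq_Ioi zero_le_one, lintegral_union measurableSet_Ioi
    (Ioc_disjoint_Ioi le_rfl)]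
  rw [setLIntegral_congr_fun (g := fun _ => 0) (s := Ioi 1) measurableSet_Ioi]
  · simp only [lintegral_zero, add_zero]
    refine setLIntegral_congr_fun measurableSet_Ioc fun u hu => ?_
    simp [hu.2, le_div_iff₀ hK]
  · intro u hu
    simp [not_le.2 (mem_Ioi.1 hu)]

theorem measure_partialQuotient_add_one_le {n : ℕ} (hn : 1 ≤ n) :
    ∀ t : ℝ, lebesgueUnit {x | t ≤ (partialQuotient n x : ℝ) + 1} ≤
      ENNReal.ofReal (gammaTail n (t / 2)) := by
  have hset : ∀ (n : ℕ) (t : ℝ), {x | t ≤ (partialQuotient n x : ℝ) + 1} =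
      {x | ⌈t - 1⌉₊ ≤ partialQuotient n x} := fun n t => by
    ext x
    simp only [mem_ofPred_eq, Nat.ceil_le, sub_le_iff_le_add]
  induction n, hn using Nat.le_induction with
  | base =>
    intro t
    rcases le_or_gt t 2 with ht | ht
    · rw [gammaTail_of_le_one (by linarith), ENNReal.ofReal_one]
      exact prob_le_one
    have hk : 1 ≤ ⌈t - 1⌉₊ := Nat.one_le_ceil_iff.2 (by linarith)
    rw [hset, measure_partialQuotient_one hk, gammaTail_of_one_lt (by linarith)]
    apply ENNReal.ofReal_le_ofReal
    have := Nat.le_ceil (t - 1)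
    simp only [Finset.range_one, Finset.sum_singleton, pow_zero, Nat.factorial_zero, Nat.cast_one,
      div_one, mul_one, one_div]
    -- The factor `2` arises here: `t - 1 ≥ t / 2` once `t ≥ 2`. Later steps lose nothing, since the
    -- upper recursion is exact for the digits plus one.
    apply inv_anti₀ <;> linarith
  | succ n hn ih =>
    intro t
    rcases le_or_gt t 2 with ht | ht
    · rw [gammaTail_of_le_one (by linarith), ENNReal.ofReal_one]
      exact prob_le_one
    have hk : 1 ≤ ⌈t - 1⌉₊ := Nat.one_le_ceil_iff.2 (by linarith)
    have hm : Measurable fun x => (partialQuotient n x : ℝ) :=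
      measurable_from_nat.comp (measurable_partialQuotient n)
    rw [hset]
    refine (measure_partialQuotient_succ_le hn hk).trans ?_
    rw [lintegral_min_one_div (X := fun x => (partialQuotient n x : ℝ) + 1) (hm.add_const 1)
      (fun x => by positivity) (by positivity)]
    calc _ ≤ ∫⁻ u in Ioc (0 : ℝ) 1,
          ENNReal.ofReal (gammaTail n (u * (((⌈t - 1⌉₊ : ℝ) + 1) / 2))) := by
          refine lintegral_mono fun u => ?_
          rw [← mul_div_assoc]
          exact ih _
      _ = ENNReal.ofReal (gammaTail (n + 1) (((⌈t - 1⌉₊ : ℝ) + 1) / 2)) := lintegral_gammaTail _ _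
      _ ≤ _ := by
          refine ENNReal.ofReal_le_ofReal (antitone_gammaTail _ ?_)
          linarith [Nat.le_ceil (t - 1)]

theorem lintegral_measure_le_measure_partialQuotient_succ {n k : ℕ} (hn : 1 ≤ n) (hk : 1 ≤ k) :
    ∫⁻ u in Ioc (0 : ℝ) 1, lebesgueUnit {x | u * (k : ℝ) ≤ partialQuotient n x} ≤
      lebesgueUnit {x | k ≤ partialQuotient (n + 1) x} := by
  have hm : Measurable fun x => (partialQuotient n x : ℝ) :=
    measurable_from_nat.comp (measurable_partialQuotient n)
  rw [← lintegral_min_one_div hm (fun x => by positivity) (by exact_mod_cast hk)]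
  exact le_measure_partialQuotient_succ hn hk

/-- Digits do not decrease before termination. Working with the one-step lower bound avoids the null
set of terminated expansions, where the value drops to `0`. -/
theorem measure_partialQuotient_ge_mono {n k : ℕ} (hn : 1 ≤ n) (hk : 1 ≤ k) (m : ℕ) :
    lebesgueUnit {x | k ≤ partialQuotient n x} ≤
      lebesgueUnit {x | k ≤ partialQuotient (n + m) x} := by
  induction m with
  | zero => rfl
  | succ m ih =>
    refine ih.trans (le_trans ?_ (lintegral_measure_le_measure_partialQuotient_succ
      (by omega : 1 ≤ n + m) hk))
    calc lebesgueUnit {x | k ≤ partialQuotient (n + m) x}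
        = ∫⁻ _u in Ioc (0 : ℝ) 1, lebesgueUnit {x | k ≤ partialQuotient (n + m) x} := by simp
      _ ≤ _ := by
        refine setLIntegral_mono' measurableSet_Ioc fun u hu => measure_mono fun x hx => ?_
        have hx' : (k : ℝ) ≤ partialQuotient (n + m) x := Nat.cast_le.2 hx
        exact (mul_le_of_le_one_left (by positivity) hu.2).trans hx'

/-- The chain is restarted at level `N` at time `M`. Levels `t ≤ N` follow from monotonicity; above
`N`, replacing `t` by `⌈t⌉₊` costs at most a factor `1 + 1/N`, paid once per step. -/
theorem mul_gammaTail_le_measure_partialQuotient {M N : ℕ} (hM : 1 ≤ M) (hN : 1 ≤ N) (m : ℕ) :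
    ∀ t : ℝ, lebesgueUnit {x | N ≤ partialQuotient M x} *
        ENNReal.ofReal (gammaTail m (t * (1 + 1 / (N : ℝ)) ^ m / N)) ≤
      lebesgueUnit {x | t ≤ partialQuotient (M + m) x} := by
  have hN' : (0 : ℝ) < N := by exact_mod_cast hN
  have hsmall : ∀ (m : ℕ) (t : ℝ), t ≤ N → lebesgueUnit {x | N ≤ partialQuotient M x} *
        ENNReal.ofReal (gammaTail m (t * (1 + 1 / (N : ℝ)) ^ m / N)) ≤
      lebesgueUnit {x | t ≤ partialQuotient (M + m) x} := fun m t ht =>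
    calc _ ≤ lebesgueUnit {x | N ≤ partialQuotient M x} * 1 := by
          gcongr
          rw [ENNReal.ofReal_le_one]
          exact gammaTail_le_one _ _
      _ ≤ lebesgueUnit {x | N ≤ partialQuotient (M + m) x} := by
          rw [mul_one]
          exact measure_partialQuotient_ge_mono hM hN m
      _ ≤ _ := measure_mono fun x hx => ht.trans (Nat.cast_le.2 hx)
  induction m with
  | zero =>
    intro t
    rcases le_or_gt t N with ht | ht
    · exact hsmall 0 t ht
    · have : 1 < t * (1 + 1 / (N : ℝ)) ^ 0 / N := by
        rw [pow_zero, mul_one, one_lt_div hN']; exact ht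
      rw [gammaTail_of_one_lt this]
      simp
  | succ m ih =>
    intro t
    rcases le_or_gt t N with ht | ht
    · exact hsmall _ t ht
    have hk : 1 ≤ ⌈t⌉₊ := Nat.one_le_ceil_iff.2 (by linarith)
    have hset : {x | t ≤ (partialQuotient (M + (m + 1)) x : ℝ)} =
        {x | ⌈t⌉₊ ≤ partialQuotient (M + m + 1) x} := by
      ext x
      simp only [mem_ofPred_eq, Nat.ceil_le, add_assoc]
    rw [hset]
    refine le_trans ?_ (lintegral_measure_le_measure_partialQuotient_succ
      (by omega : 1 ≤ M + m) hk)
    have hceil : (⌈t⌉₊ : ℝ) ≤ t * (1 + 1 / (N : ℝ)) := by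
      have h1 := (Nat.ceil_lt_add_one (by linarith : 0 ≤ t)).le
      have h2 : 1 ≤ t * (1 / (N : ℝ)) := by
        rw [mul_one_div, one_le_div hN']; exact ht.le
      linarith
    calc lebesgueUnit {x | N ≤ partialQuotient M x} *
          ENNReal.ofReal (gammaTail (m + 1) (t * (1 + 1 / (N : ℝ)) ^ (m + 1) / N))
        ≤ lebesgueUnit {x | N ≤ partialQuotient M x} *
          ENNReal.ofReal (gammaTail (m + 1) (⌈t⌉₊ * (1 + 1 / (N : ℝ)) ^ m / N)) := by
          gcongr
          refine antitone_gammaTail _ ?_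
          rw [pow_succ', ← mul_assoc]
          gcongr
      _ = ∫⁻ u in Ioc (0 : ℝ) 1, lebesgueUnit {x | N ≤ partialQuotient M x} *
          ENNReal.ofReal (gammaTail m (u * (⌈t⌉₊ * (1 + 1 / (N : ℝ)) ^ m / N))) := by
          rw [lintegral_const_mul' _ _ (measure_ne_top _ _), lintegral_gammaTail]
      _ ≤ _ := by
          refine lintegral_mono fun u => ?_
          have := ih (u * ⌈t⌉₊)
          rwa [mul_assoc u, mul_div_assoc u] at this

theorem real_exp_le_partialQuotient_le {n : ℕ} (hn : 1 ≤ n) (s : ℝ) :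
    lebesgueUnit.real {x | Real.exp s ≤ partialQuotient n x} ≤
      gammaTail n (Real.exp (s - Real.log 2)) := by
  rw [Real.exp_sub, Real.exp_log two_pos]
  refine ENNReal.toReal_le_of_le_ofReal (gammaTail_nonneg _ _)
    (le_trans (measure_mono fun x hx => ?_) (measure_partialQuotient_add_one_le hn _))
  exact (show Real.exp s ≤ _ from hx).trans (by simp)

theorem mul_gammaTail_le_real_partialQuotient {M N m : ℕ} (hM : 1 ≤ M) (hN : 1 ≤ N) (hm : m ≤ N)
    (s : ℝ) :
    lebesgueUnit.real {x | N ≤ partialQuotient M x} * gammaTail m (Real.exp (s + 1)) ≤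
      lebesgueUnit.real {x | Real.exp s ≤ partialQuotient (M + m) x} := by
  have hN' : (1 : ℝ) ≤ N := by exact_mod_cast hN
  have h := ENNReal.toReal_mono (measure_ne_top _ _)
    (mul_gammaTail_le_measure_partialQuotient hM hN m (Real.exp s))
  rw [ENNReal.toReal_mul, ENNReal.toReal_ofReal (gammaTail_nonneg _ _)] at h
  refine le_trans ?_ h
  refine mul_le_mul_of_nonneg_left (antitone_gammaTail _ ?_) measureReal_nonneg
  rw [Real.exp_add, mul_div_assoc]
  gcongr
  refine (div_le_self (by positivity) hN').trans ?_
  calc (1 + 1 / (N : ℝ)) ^ m ≤ (1 + 1 / (N : ℝ)) ^ N :=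
        pow_le_pow_right₀ (by simp) hm
    _ ≤ (Real.exp (1 / N)) ^ N := by
        gcongr
        linarith [Real.add_one_le_exp (1 / (N : ℝ))]
    _ = Real.exp 1 := by
        rw [← Real.exp_nat_mul]; congr 1; field_simp

/-- The restart bound with `N = 1`, where `b_1 ≥ 1` has probability one, costs a factor `2` per
step. Chernoff with `x = 3/2` still gives exponential decay because `(3/2)² > 2`. -/
theorem one_sub_real_partialQuotient_le {N : ℕ} (hN : 2 ≤ N) (m : ℕ) :
    1 - lebesgueUnit.real {x | N ≤ partialQuotient (1 + m) x} ≤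
      Real.exp (Real.log N / 2 - m * (Real.log (3 / 2) - Real.log 2 / 2)) := by
  have hN' : (1 : ℝ) < N := by exact_mod_cast hN
  have h := ENNReal.toReal_mono (measure_ne_top _ _)
    (mul_gammaTail_le_measure_partialQuotient le_rfl le_rfl m (N : ℝ))
  rw [measure_partialQuotient_one le_rfl] at h
  norm_num [gammaTail_nonneg] at h
  have hs : 0 < Real.log N + m * Real.log 2 := by
    have := Real.log_pos hN'
    have := Real.log_pos one_lt_two
    positivity
  have h2 := one_sub_gammaTail_exp_le (n := m) hs (by norm_num : (1 : ℝ) ≤ 3 / 2)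
  have h3 : Real.exp (Real.log N + m * Real.log 2) = N * 2 ^ m := by
    rw [Real.exp_add, Real.exp_log (by linarith), Real.exp_nat_mul, Real.exp_log two_pos]
  rw [h3] at h2
  have h4 : ((3 : ℝ) / 2) ^ m = Real.exp (m * Real.log (3 / 2)) := by
    rw [Real.exp_nat_mul, Real.exp_log (by norm_num)]
  rw [h4, ← Real.exp_sub] at h2
  calc _ ≤ 1 - gammaTail m (N * 2 ^ m) := sub_le_sub_left h _
    _ ≤ _ := h2
    _ = _ := by congr 1; ring

/-! ### Elementary estimates and the Gaussian rate of Gamma tails -/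

theorem abs_log_one_add_sub_add_sq_le {u : ℝ} (hu : |u| ≤ 1 / 2) :
    |Real.log (1 + u) - u + u ^ 2 / 2| ≤ 2 * |u| * u ^ 2 := by
  have h := Real.abs_log_sub_add_sum_range_le (x := -u) (by rw [abs_neg]; linarith) 2
  norm_num [Finset.sum_range_succ] at h
  rw [show Real.log (1 + u) - u + u ^ 2 / 2 = -u + u ^ 2 / 2 + Real.log (1 + u) by ring]
  refine h.trans ?_
  rw [div_le_iff₀ (by linarith), ← sq_abs u]
  have := abs_nonneg u
  nlinarith [pow_nonneg this 3]

theorem factorial_le_mul_exp {m : ℕ} (hm : 1 ≤ m) :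
    (m.factorial : ℝ) ≤ (m : ℝ) ^ (m + 1) * Real.exp (1 - m) := by
  induction m, hm using Nat.le_induction with
  | base => simp
  | succ m hm ih =>
    have hm' : (0 : ℝ) < m := by exact_mod_cast hm
    have h : (m : ℝ) ^ (m + 1) ≤ ((m : ℝ) + 1) ^ (m + 1) * Real.exp (-1) := by
      have h1 : (m : ℝ) / (m + 1) ≤ Real.exp (-(1 / ((m : ℝ) + 1))) := by
        refine le_trans (le_of_eq ?_) (Real.add_one_le_exp _)
        field_simp
        ring
      have h2 := pow_le_pow_left₀ (by positivity) h1 (m + 1)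
      rw [← Real.exp_nat_mul, div_pow, div_le_iff₀ (by positivity)] at h2
      refine h2.trans (le_of_eq ?_)
      rw [mul_comm]
      congr 2
      push_cast
      field_simp
    rw [Nat.factorial_succ]
    push_cast
    calc ((m : ℝ) + 1) * m.factorial
        ≤ (m + 1) * ((((m : ℝ) + 1) ^ (m + 1) * Real.exp (-1)) * Real.exp (1 - m)) := by
          gcongr
          exact ih.trans (by gcongr)
      _ = _ := by
          rw [mul_assoc _ (Real.exp (-1)), ← Real.exp_add]
          ring_nf

section Asymptotics

variable {p α : ℝ} {m : ℕ → ℕ} {σ : ℕ → ℝ}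

theorem tendsto_nat_rpow_atTop {q : ℝ} (hq : 0 < q) :
    Tendsto (fun n : ℕ => (n : ℝ) ^ q) atTop atTop :=
  (tendsto_rpow_atTop hq).comp tendsto_natCast_atTop_atTop

theorem tendsto_nat_rpow_zero {q : ℝ} (hq : q < 0) :
    Tendsto (fun n : ℕ => (n : ℝ) ^ q) atTop (𝓝 0) := by
  have h := (tendsto_rpow_neg_atTop (neg_pos.2 hq)).comp tendsto_natCast_atTop_atTop
  simpa [Function.comp_def] using h

theorem tendsto_const_div_nat_rpow {q : ℝ} (hq : 0 < q) (c : ℝ) :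
    Tendsto (fun n : ℕ => c / (n : ℝ) ^ q) atTop (𝓝 0) :=
  (tendsto_nat_rpow_atTop hq).const_div_atTop c

theorem eventually_pos_of_tendsto_div (hm : Tendsto (fun n => (m n : ℝ) / n) atTop (𝓝 1)) :
    ∀ᶠ n in atTop, 0 < m n := by
  filter_upwards [hm.eventually_const_lt zero_lt_one] with n hn
  rcases Nat.eq_zero_or_pos (m n) with h | h
  · simp [h] at hn
  · exact h

theorem tendsto_relative_error (hp' : p < 1)
    (hm : Tendsto (fun n => (m n : ℝ) / n) atTop (𝓝 1))
    (hσ : Tendsto (fun n => (σ n - m n) / (n : ℝ) ^ p) atTop (𝓝 α)) :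
    Tendsto (fun n => (σ n - m n) / m n) atTop (𝓝 0) := by
  have h := (hσ.mul (tendsto_nat_rpow_zero (sub_neg.2 hp'))).mul (hm.inv₀ one_ne_zero)
  rw [mul_zero, zero_mul] at h
  refine h.congr' ?_
  filter_upwards [eventually_gt_atTop 0, eventually_pos_of_tendsto_div hm] with n hn hmn
  have hn' : (0 : ℝ) < n := by exact_mod_cast hn
  have hmn' : (0 : ℝ) < m n := by exact_mod_cast hmn
  rw [Real.rpow_sub_one hn'.ne']
  field_simp

/-- With `u = (σ - m) / m → 0` the exponent is `m (log (1 + u) - u)`, so it is `-m u² / 2` up to a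
relative error `O(|u|)`, and `m u²` is asymptotic to `α² n ^ (2p - 1)`. -/
theorem tendsto_poisson_exponent (hp' : p < 1)
    (hm : Tendsto (fun n => (m n : ℝ) / n) atTop (𝓝 1))
    (hσ : Tendsto (fun n => (σ n - m n) / (n : ℝ) ^ p) atTop (𝓝 α)) :
    Tendsto (fun n => (m n * Real.log (σ n / m n) + m n - σ n) / (n : ℝ) ^ (2 * p - 1)) atTop
      (𝓝 (-(α ^ 2 / 2))) := by
  have hu := tendsto_relative_error hp' hm hσ
  set u : ℕ → ℝ := fun n => (σ n - m n) / m n with hudef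
  have hsq : Tendsto (fun n => m n * u n ^ 2 / (n : ℝ) ^ (2 * p - 1)) atTop (𝓝 (α ^ 2)) := by
    have h := (hσ.pow 2).mul (hm.inv₀ one_ne_zero)
    rw [inv_one, mul_one] at h
    refine h.congr' ?_
    filter_upwards [eventually_gt_atTop 0, eventually_pos_of_tendsto_div hm] with n hn hmn
    have hn' : (0 : ℝ) < n := by exact_mod_cast hn
    have hmn' : (0 : ℝ) < m n := by exact_mod_cast hmn
    rw [Real.rpow_sub_one hn'.ne', two_mul, Real.rpow_add hn']
    simp only [hudef]
    field_simp
  have herr : Tendsto (fun n => (m n * (Real.log (1 + u n) - u n + u n ^ 2 / 2)) /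
      (n : ℝ) ^ (2 * p - 1)) atTop (𝓝 0) := by
    have h := (hu.abs.const_mul 2).mul hsq
    rw [abs_zero, mul_zero, zero_mul] at h
    refine squeeze_zero_norm' ?_ h
    have hsmall : ∀ᶠ n in atTop, |u n| < 1 / 2 :=
      (by simpa using hu.abs : Tendsto (fun n => |u n|) atTop (𝓝 0)).eventually_lt_const
        (by norm_num)
    filter_upwards [hsmall] with n hn
    rw [Real.norm_eq_abs, abs_div, abs_mul, Nat.abs_cast,
      abs_of_nonneg (Real.rpow_nonneg (Nat.cast_nonneg n) _)]
    calc _ ≤ m n * (2 * |u n| * u n ^ 2) / (n : ℝ) ^ (2 * p - 1) := by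
          gcongr
          exact abs_log_one_add_sub_add_sq_le hn.le
      _ = _ := by ring
  have h := herr.sub (hsq.div_const 2)
  rw [zero_sub] at h
  refine h.congr' ?_
  filter_upwards [eventually_pos_of_tendsto_div hm] with n hmn
  have hmn' : (0 : ℝ) < m n := by exact_mod_cast hmn
  have h1 : σ n / m n = 1 + u n := by
    simp only [hudef]; field_simp; ring
  have h2 : σ n = m n + m n * u n := by
    simp only [hudef]; field_simp; ring
  rw [h1, h2]
  ring

theorem eventually_sigma_mem (hp' : p < 1)
    (hm : Tendsto (fun n => (m n : ℝ) / n) atTop (𝓝 1))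
    (hσ : Tendsto (fun n => (σ n - m n) / (n : ℝ) ^ p) atTop (𝓝 α)) :
    ∀ᶠ n in atTop, 0 < m n ∧ 0 < σ n ∧ (m n : ℝ) ≤ 3 * n ∧ σ n ≤ 3 * n := by
  have hu := tendsto_relative_error hp' hm hσ
  filter_upwards [eventually_gt_atTop 0, eventually_pos_of_tendsto_div hm,
    hu.eventually_const_lt (by norm_num : (-1 : ℝ) < 0),
    hu.eventually_lt_const (by norm_num : (0 : ℝ) < 1 / 2),
    hm.eventually_lt_const (by norm_num : (1 : ℝ) < 2)] with n hn hmn h1 h2 h3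
  have hn' : (0 : ℝ) < n := by exact_mod_cast hn
  have hmn' : (0 : ℝ) < m n := by exact_mod_cast hmn
  rw [lt_div_iff₀ hmn'] at h1
  rw [div_lt_iff₀ hmn'] at h2
  rw [div_lt_iff₀ hn'] at h3
  refine ⟨hmn, ?_, ?_, ?_⟩ <;> linarith

theorem exp_poisson_exponent {m : ℕ} {σ : ℝ} (hm : 0 < m) (hσ : 0 < σ) :
    Real.exp (m * Real.log (σ / m) + m - σ) = σ ^ m / (m : ℝ) ^ m * Real.exp (m - σ) := by
  have hm' : (0 : ℝ) < m := by exact_mod_cast hm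
  rw [add_sub_assoc, Real.exp_add, Real.exp_nat_mul, Real.exp_log (by positivity), div_pow]

theorem eventually_exp_poisson_exponent_le (hp' : p < 1)
    (hm : Tendsto (fun n => (m n : ℝ) / n) atTop (𝓝 1))
    (hσ : Tendsto (fun n => (σ n - m n) / (n : ℝ) ^ p) atTop (𝓝 α)) {c : ℝ}
    (hc : c < α ^ 2 / 2) :
    ∀ᶠ n : ℕ in atTop, Real.exp (m n * Real.log (σ n / m n) + m n - σ n) ≤
      Real.exp (-c * (n : ℝ) ^ (2 * p - 1)) := by
  filter_upwards [eventually_gt_atTop 0, (tendsto_poisson_exponent hp' hm hσ).eventually_lt_const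
    (neg_lt_neg hc)] with n hn h
  have hn' : (0 : ℝ) < n := by exact_mod_cast hn
  rw [div_lt_iff₀ (by positivity)] at h
  exact Real.exp_le_exp.2 h.le

theorem eventually_log_nat_le_rpow {q : ℝ} (hq : 0 < q) {ε : ℝ} (hε : 0 < ε) :
    ∀ᶠ n : ℕ in atTop, Real.log n ≤ ε * (n : ℝ) ^ q := by
  have h := ((isLittleO_log_rpow_atTop hq).comp_tendsto tendsto_natCast_atTop_atTop).def hε
  filter_upwards [h] with n hn
  simp only [Function.comp, Real.norm_eq_abs] at hn
  rw [abs_of_nonneg (Real.rpow_nonneg (Nat.cast_nonneg n) _)] at hn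
  exact (le_abs_self _).trans hn

/-- The factor `3 e n` covers the loss in the factorial bound. Being polynomial, it is absorbed by
`exp (ε n ^ (2p - 1))`; this is where `p > 1/2` enters. -/
theorem eventually_le_exp_poisson_exponent (hp : 1 / 2 < p) (hp' : p < 1)
    (hm : Tendsto (fun n => (m n : ℝ) / n) atTop (𝓝 1))
    (hσ : Tendsto (fun n => (σ n - m n) / (n : ℝ) ^ p) atTop (𝓝 α)) {c : ℝ}
    (hc : α ^ 2 / 2 < c) :
    ∀ᶠ n : ℕ in atTop, Real.exp (-c * (n : ℝ) ^ (2 * p - 1)) ≤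
      Real.exp (m n * Real.log (σ n / m n) + m n - σ n) / (Real.exp 1 * (3 * n)) := by
  obtain ⟨d, hd1, hd2⟩ := exists_between hc
  have hq : 0 < 2 * p - 1 := by linarith
  have hcd : 0 < (c - d) / 2 := by linarith
  filter_upwards [eventually_gt_atTop 0, (tendsto_poisson_exponent hp' hm hσ).eventually_const_lt
    (neg_lt_neg hd1), eventually_log_nat_le_rpow hq hcd,
    (tendsto_nat_rpow_atTop hq).eventually_ge_atTop ((1 + Real.log 3) / ((c - d) / 2))]
    with n hn h h2 h3
  have hn' : (0 : ℝ) < n := by exact_mod_cast hn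
  rw [lt_div_iff₀ (by positivity)] at h
  rw [div_le_iff₀ hcd] at h3
  rw [le_div_iff₀ (by positivity)]
  calc Real.exp (-c * (n : ℝ) ^ (2 * p - 1)) * (Real.exp 1 * (3 * n))
      = Real.exp (-c * (n : ℝ) ^ (2 * p - 1) + (1 + (Real.log 3 + Real.log n))) := by
        rw [Real.exp_add, Real.exp_add, Real.exp_add, Real.exp_log three_pos, Real.exp_log hn']
    _ ≤ _ := Real.exp_le_exp.2 (by linarith)

theorem eventually_gammaTail_le (hp' : p < 1) (hα : 0 < α)
    (hm : Tendsto (fun n => (m n : ℝ) / n) atTop (𝓝 1))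
    (hσ : Tendsto (fun n => (σ n - m n) / (n : ℝ) ^ p) atTop (𝓝 α)) {c : ℝ}
    (hc : c < α ^ 2 / 2) :
    ∀ᶠ n : ℕ in atTop,
      gammaTail (m n) (Real.exp (σ n)) ≤ Real.exp (-c * (n : ℝ) ^ (2 * p - 1)) := by
  filter_upwards [eventually_exp_poisson_exponent_le hp' hm hσ hc,
    eventually_sigma_mem hp' hm hσ, hσ.eventually_const_lt hα, eventually_gt_atTop 0]
    with n h ⟨h1, h2, _, _⟩ h3 hn
  have hn' : (0 : ℝ) < n := by exact_mod_cast hn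
  have h1' : (0 : ℝ) < m n := by exact_mod_cast h1
  rw [lt_div_iff₀ (by positivity), zero_mul] at h3
  refine (gammaTail_exp_le h2 (by positivity : 0 < (m n : ℝ) / σ n)
    ((div_le_one h2).2 (by linarith))).trans (le_trans (le_of_eq ?_) h)
  rw [exp_poisson_exponent h1 h2, mul_div_cancel₀ _ h2.ne', div_pow]
  field_simp

theorem eventually_one_sub_gammaTail_le (hp' : p < 1) (hα : α < 0)
    (hm : Tendsto (fun n => (m n : ℝ) / n) atTop (𝓝 1))
    (hσ : Tendsto (fun n => (σ n - m n) / (n : ℝ) ^ p) atTop (𝓝 α)) {c : ℝ}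
    (hc : c < α ^ 2 / 2) :
    ∀ᶠ n : ℕ in atTop,
      1 - gammaTail (m n) (Real.exp (σ n)) ≤ Real.exp (-c * (n : ℝ) ^ (2 * p - 1)) := by
  filter_upwards [eventually_exp_poisson_exponent_le hp' hm hσ hc,
    eventually_sigma_mem hp' hm hσ, hσ.eventually_lt_const hα, eventually_gt_atTop 0]
    with n h ⟨h1, h2, _, _⟩ h3 hn
  have hn' : (0 : ℝ) < n := by exact_mod_cast hn
  have h1' : (0 : ℝ) < m n := by exact_mod_cast h1
  rw [div_lt_iff₀ (by positivity), zero_mul] at h3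
  refine (one_sub_gammaTail_exp_le h2 (x := (m n : ℝ) / σ n)
    ((one_le_div h2).2 (by linarith))).trans (le_trans (le_of_eq ?_) h)
  rw [exp_poisson_exponent h1 h2, mul_div_cancel₀ _ h2.ne', div_pow]
  field_simp

theorem exp_poisson_exponent_div_le {m : ℕ} {σ : ℝ} (hm : 0 < m) (hσ : 0 < σ) :
    Real.exp (m * Real.log (σ / m) + m - σ) / (Real.exp 1 * m) ≤
      Real.exp (-σ) * (σ ^ m / (m.factorial : ℝ)) := by
  have hm' : (0 : ℝ) < m := by exact_mod_cast hm
  have h := factorial_le_mul_exp hm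
  calc _ = Real.exp (-σ) * (σ ^ m / ((m : ℝ) ^ (m + 1) * Real.exp (1 - m))) := by
        rw [exp_poisson_exponent hm hσ, sub_eq_add_neg, sub_eq_add_neg, Real.exp_add, Real.exp_add,
          Real.exp_neg (m : ℝ)]
        field_simp
        rw [pow_succ]
    _ ≤ _ := by gcongr

theorem eventually_le_one_sub_gammaTail (hp : 1 / 2 < p) (hp' : p < 1)
    (hm : Tendsto (fun n => (m n : ℝ) / n) atTop (𝓝 1))
    (hσ : Tendsto (fun n => (σ n - m n) / (n : ℝ) ^ p) atTop (𝓝 α)) {c : ℝ}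
    (hc : α ^ 2 / 2 < c) :
    ∀ᶠ n : ℕ in atTop,
      Real.exp (-c * (n : ℝ) ^ (2 * p - 1)) ≤ 1 - gammaTail (m n) (Real.exp (σ n)) := by
  filter_upwards [eventually_le_exp_poisson_exponent hp hp' hm hσ hc,
    eventually_sigma_mem hp' hm hσ] with n h ⟨h1, h2, h3, _⟩
  have h1' : (0 : ℝ) < m n := by exact_mod_cast h1
  refine h.trans (le_trans ?_ ((exp_poisson_exponent_div_le h1 h2).trans
    (le_one_sub_gammaTail_exp h2)))
  gcongr

theorem eventually_le_gammaTail (hp : 1 / 2 < p) (hp' : p < 1)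
    (hm : Tendsto (fun n => (m n : ℝ) / n) atTop (𝓝 1))
    (hσ : Tendsto (fun n => (σ n - m n) / (n : ℝ) ^ p) atTop (𝓝 α)) {c : ℝ}
    (hc : α ^ 2 / 2 < c) :
    ∀ᶠ n : ℕ in atTop,
      Real.exp (-c * (n : ℝ) ^ (2 * p - 1)) ≤ gammaTail (m n) (Real.exp (σ n)) := by
  filter_upwards [eventually_le_exp_poisson_exponent hp hp' hm hσ hc,
    eventually_sigma_mem hp' hm hσ] with n h ⟨h1, h2, _, h3⟩
  have h1' : (0 : ℝ) < m n := by exact_mod_cast h1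
  refine h.trans (le_trans ?_ (le_gammaTail_exp h1 h2))
  calc _ ≤ Real.exp (m n * Real.log (σ n / m n) + m n - σ n) / (Real.exp 1 * σ n) := by gcongr
    -- The tail contains the Poisson term of index `m - 1`, which is `m / σ` times the term of index
    -- `m` controlled by the factorial bound.
    _ = Real.exp (m n * Real.log (σ n / m n) + m n - σ n) / (Real.exp 1 * m n) * (m n / σ n) := by
        field_simp
    _ ≤ Real.exp (-σ n) * (σ n ^ m n / ((m n).factorial : ℝ)) * (m n / σ n) := by
        gcongr
        exact exp_poisson_exponent_div_le h1 h2
    _ = _ := by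
        obtain ⟨k, hk⟩ := Nat.exists_eq_add_of_le' h1
        rw [hk, Nat.add_sub_cancel, Nat.factorial_succ, pow_succ]
        push_cast
        field_simp

end Asymptotics

/-! ### From tail rates to the large deviation principle -/

theorem eventually_two_mul_exp_le {s : ℕ → ℝ} (hs : Tendsto s atTop atTop) {c d : ℝ} (h : c < d) :
    ∀ᶠ n in atTop, 2 * Real.exp (-d * s n) ≤ Real.exp (-c * s n) := by
  have hcd : 0 < d - c := sub_pos.2 h
  filter_upwards [hs.eventually_ge_atTop (Real.log 2 / (d - c))] with n hn
  rw [div_le_iff₀ hcd] at hn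
  calc 2 * Real.exp (-d * s n) = Real.exp (Real.log 2 + -d * s n) := by
        rw [Real.exp_add, Real.exp_log two_pos]
    _ ≤ _ := Real.exp_le_exp.2 (by linarith)

theorem isGoodRateFunction_half_sq :
    IsGoodRateFunction fun x : ℝ => ENNReal.ofReal (x ^ 2 / 2) where
  lowerSemicontinuous := (ENNReal.continuous_ofReal.comp
    (by fun_prop : Continuous fun x : ℝ => x ^ 2 / 2)).lowerSemicontinuous
  isCompact_sublevel α := by
    refine (isCompact_Icc (a := -Real.sqrt (2 * α)) (b := Real.sqrt (2 * α))).of_isClosed_subset ?_ ?_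
    · exact isClosed_le (ENNReal.continuous_ofReal.comp
        (by fun_prop : Continuous fun x : ℝ => x ^ 2 / 2)) continuous_const
    · intro x hx
      have h : x ^ 2 / 2 ≤ α := by
        have := ENNReal.toReal_mono ENNReal.coe_ne_top (mem_ofPred_eq ▸ hx)
        rwa [ENNReal.toReal_ofReal (by positivity), ENNReal.coe_toReal] at this
      exact abs_le.1 (Real.abs_le_sqrt (by linarith))

section

variable {Ω : Type*} [MeasurableSpace Ω] {P : Measure Ω} [IsProbabilityMeasure P]

theorem mul_log_measure_le {A : Set Ω} {s c : ℝ} (hs : 0 < s)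
    (h : P.real A ≤ Real.exp (-c * s)) :
    ((1 / s : ℝ) : EReal) * ENNReal.log (P A) ≤ ((-c : ℝ) : EReal) := by
  have h1 : ENNReal.log (P A) ≤ ((-c * s : ℝ) : EReal) := by
    rw [← Real.log_exp (-c * s), ← ENNReal.log_ofReal_of_pos (Real.exp_pos _),
      ENNReal.log_le_log_iff, ← ofReal_measureReal]
    exact ENNReal.ofReal_le_ofReal h
  calc _ ≤ ((1 / s : ℝ) : EReal) * ((-c * s : ℝ) : EReal) :=
        mul_le_mul_of_nonneg_left h1 (by exact_mod_cast (by positivity : 0 ≤ 1 / s))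
    _ = _ := by
      rw [← EReal.coe_mul]
      congr 1
      field_simp

theorem le_mul_log_measure {A : Set Ω} {s c : ℝ} (hs : 0 < s)
    (h : Real.exp (-c * s) ≤ P.real A) :
    ((-c : ℝ) : EReal) ≤ ((1 / s : ℝ) : EReal) * ENNReal.log (P A) := by
  have h1 : ((-c * s : ℝ) : EReal) ≤ ENNReal.log (P A) := by
    rw [← Real.log_exp (-c * s), ← ENNReal.log_ofReal_of_pos (Real.exp_pos _),
      ENNReal.log_le_log_iff, ← ofReal_measureReal]
    exact ENNReal.ofReal_le_ofReal h
  calc _ = ((1 / s : ℝ) : EReal) * ((-c * s : ℝ) : EReal) := by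
        rw [← EReal.coe_mul]
        congr 1
        field_simp
    _ ≤ _ := mul_le_mul_of_nonneg_left h1 (by exact_mod_cast (by positivity : 0 ≤ 1 / s))

/-- A sequence of random variables whose two tails decay at the exact exponential rate `a² / 2`
satisfies the large deviation principle with rate function `x² / 2`. -/
theorem satisfiesLDP_of_tails {X : ℕ → Ω → ℝ} {s : ℕ → ℝ}
    (hX : ∀ n, 1 ≤ n → Measurable (X n)) (hs : Tendsto s atTop atTop)
    (upper_le : ∀ a c : ℝ, 0 < a → c < a ^ 2 / 2 →
      ∀ᶠ n in atTop, P.real {ω | a ≤ X n ω} ≤ Real.exp (-c * s n))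
    (le_upper : ∀ a c : ℝ, 0 < a → a ^ 2 / 2 < c →
      ∀ᶠ n in atTop, Real.exp (-c * s n) ≤ P.real {ω | a ≤ X n ω})
    (lower_le : ∀ a c : ℝ, 0 < a → c < a ^ 2 / 2 →
      ∀ᶠ n in atTop, P.real {ω | X n ω < -a} ≤ Real.exp (-c * s n))
    (le_lower : ∀ a c : ℝ, 0 < a → a ^ 2 / 2 < c →
      ∀ᶠ n in atTop, Real.exp (-c * s n) ≤ P.real {ω | X n ω < -a}) :
    SatisfiesLDP P X s fun x : ℝ => ENNReal.ofReal (x ^ 2 / 2) where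
  isProbabilityMeasure := inferInstance
  measurable := hX
  tendsto_speed := hs
  good := isGoodRateFunction_half_sq
  upper_bound Γ _ := by
    refine EReal.le_of_forall_lt_iff_le.1 fun z hz => ?_
    obtain ⟨c, rfl⟩ : ∃ c, z = -c := ⟨-z, by simp⟩
    refine limsup_le_of_le (by isBoundedDefault) ?_
    rw [EReal.coe_neg, EReal.neg_lt_neg_iff] at hz
    rcases le_or_gt c 0 with hc0 | hc0
    · filter_upwards [hs.eventually_gt_atTop 0] with n hn
      refine mul_log_measure_le hn (measureReal_le_one.trans (Real.one_le_exp ?_))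
      nlinarith
    obtain ⟨d, hd1, hd2⟩ : ∃ d : ℝ, c < d ∧ (d : EReal) < ⨅ x ∈ closure Γ,
        ((ENNReal.ofReal (x ^ 2 / 2) : ℝ≥0∞) : EReal) := by
      obtain ⟨d, hd1, hd2⟩ := EReal.lt_iff_exists_real_btwn.1 hz
      exact ⟨d, by exact_mod_cast hd1, hd2⟩
    obtain ⟨d', hd'1, hd'2⟩ := exists_between hd1
    have hd0 : 0 < d := hc0.trans hd1
    have hΓ : ∀ x ∈ Γ, d ≤ x ^ 2 / 2 := fun x hx => by
      have h := hd2.le.trans (iInf₂_le x (subset_closure hx))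
      rw [EReal.coe_ennreal_ofReal, max_eq_left (by positivity)] at h
      exact_mod_cast h
    have ha : 0 < Real.sqrt (2 * d') := Real.sqrt_pos.2 (by linarith)
    have hsq : Real.sqrt (2 * d') ^ 2 = 2 * d' := Real.sq_sqrt (by linarith)
    obtain ⟨e, he1, he2⟩ := exists_between hd'1
    filter_upwards [hs.eventually_gt_atTop 0, eventually_two_mul_exp_le hs he1,
      upper_le _ e ha (by linarith), lower_le _ e ha (by linarith)] with n h0 h1 h2 h3
    refine mul_log_measure_le h0 ?_
    calc P.real {ω | X n ω ∈ Γ}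
        ≤ P.real ({ω | Real.sqrt (2 * d') ≤ X n ω} ∪ {ω | X n ω < -Real.sqrt (2 * d')}) := by
          refine measureReal_mono fun ω hω => ?_
          by_contra hcon
          simp only [mem_union, mem_ofPred_eq, not_or, not_le, not_lt] at hcon
          have := hΓ _ hω
          have := sq_le_sq' hcon.2 hcon.1.le
          linarith
      _ ≤ _ := measureReal_union_le _ _
      _ ≤ _ := by linarith
  lower_bound Γ _ := by
    refine EReal.ge_of_forall_gt_iff_ge.1 fun z hz => ?_
    obtain ⟨c, rfl⟩ : ∃ c, z = -c := ⟨-z, by simp⟩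
    rw [EReal.coe_neg, EReal.neg_lt_neg_iff] at hz
    simp only [iInf_lt_iff] at hz
    obtain ⟨x₀, hx₀, hx₀c⟩ := hz
    rw [EReal.coe_ennreal_ofReal, max_eq_left (by positivity), EReal.coe_lt_coe_iff] at hx₀c
    -- The tail hypotheses concern only `a > 0`, so the point is moved off `0` inside the open set.
    -- Near it, the mass of `Γ` is at least a difference of two tails, the farther one being
    -- exponentially smaller.
    obtain ⟨x, ⟨hx, hxc⟩, hx0⟩ : ∃ x ∈ interior Γ ∩ {x : ℝ | x ^ 2 / 2 < c}, x ≠ 0 := by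
      have ho : IsOpen (interior Γ ∩ {x : ℝ | x ^ 2 / 2 < c}) :=
        isOpen_interior.inter (isOpen_lt (by fun_prop) continuous_const)
      obtain ⟨x, hx, hx'⟩ := (dense_compl_singleton (0 : ℝ)).inter_open_nonempty _ ho
        ⟨x₀, hx₀, hx₀c⟩
      exact ⟨x, hx, hx'⟩
    obtain ⟨δ, hδ, hball⟩ := Metric.isOpen_iff.1 isOpen_interior x hx
    have hball' : ∀ y, |y - x| < δ → y ∈ Γ := fun y hy => interior_subset (hball hy)
    refine le_liminf_of_le (by isBoundedDefault) ?_
    simp only [mem_ofPred_eq] at hxc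
    have key : ∀ a b : ℝ, 0 < a → a < b → a ^ 2 / 2 < c → ∃ d e : ℝ, a ^ 2 / 2 < d ∧ d < e ∧
        e < b ^ 2 / 2 ∧ d < c := by
      intro a b ha hab hac
      obtain ⟨e, he1, he2⟩ := exists_between
        (lt_min hac (by nlinarith : a ^ 2 / 2 < b ^ 2 / 2))
      obtain ⟨d, hd1, hd2⟩ := exists_between he1
      exact ⟨d, e, hd1, hd2, he2.trans_le (min_le_right _ _),
        hd2.trans (he2.trans_le (min_le_left _ _))⟩
    rcases hx0.lt_or_gt with hneg | hpos
    · obtain ⟨d, e, h1, h2, h3, h4⟩ := key (-x) (-x + δ / 2) (by linarith) (by linarith)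
        (by rwa [neg_sq])
      filter_upwards [hs.eventually_gt_atTop 0, eventually_two_mul_exp_le hs h2,
        eventually_two_mul_exp_le hs h4, le_lower _ d (by linarith) h1,
        lower_le _ e (by linarith) h3] with n g0 g1 g2 g3 g4
      refine le_mul_log_measure g0 ?_
      have hsub : P.real {ω | X n ω < - -x} ≤
          P.real {ω | X n ω ∈ Γ} + P.real {ω | X n ω < -(-x + δ / 2)} := by
        refine le_trans (measureReal_mono fun ω hω => ?_) (measureReal_union_le _ _)
        rcases lt_or_ge (X n ω) (-(-x + δ / 2)) with h | h
        · exact Or.inr h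
        · left
          simp only [mem_ofPred_eq] at hω
          exact hball' _ (abs_lt.2 ⟨by linarith, by linarith⟩)
      linarith
    · obtain ⟨d, e, h1, h2, h3, h4⟩ := key x (x + δ) hpos (by linarith) hxc
      filter_upwards [hs.eventually_gt_atTop 0, eventually_two_mul_exp_le hs h2,
        eventually_two_mul_exp_le hs h4, le_upper _ d hpos h1,
        upper_le _ e (by linarith) h3] with n g0 g1 g2 g3 g4
      refine le_mul_log_measure g0 ?_
      have hsub : P.real {ω | x ≤ X n ω} ≤
          P.real {ω | X n ω ∈ Γ} + P.real {ω | x + δ ≤ X n ω} := by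
        refine le_trans (measureReal_mono fun ω hω => ?_) (measureReal_union_le _ _)
        rcases le_or_gt (x + δ) (X n ω) with h | h
        · exact Or.inr h
        · left
          simp only [mem_ofPred_eq] at hω
          exact hball' _ (abs_lt.2 ⟨by linarith, by linarith⟩)
      linarith

end

/-! ### Tails of the scaled logarithm -/

/-- The centred and scaled logarithm `(log bₙ - n) / n ^ p` of the `n`-th partial quotient. -/
noncomputable def scaledLog (p : ℝ) (n : ℕ) (x : ℝ) : ℝ :=
  (Real.log (partialQuotient n x) - n) / (n : ℝ) ^ p

theorem measurable_scaledLog (p : ℝ) (n : ℕ) : Measurable (scaledLog p n) := by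
  have hm : Measurable fun x => (partialQuotient n x : ℝ) :=
    measurable_from_nat.comp (measurable_partialQuotient n)
  exact ((Real.measurable_log.comp hm).sub_const _).div_const _

section

variable {p a c : ℝ}

theorem tendsto_add_mul_rpow_sub_div {m : ℕ → ℕ} (hp : 0 < p) (a b : ℝ)
    (hm : Tendsto (fun n : ℕ => ((n : ℝ) - m n) / (n : ℝ) ^ p) atTop (𝓝 0)) :
    Tendsto (fun n : ℕ => ((n : ℝ) + a * (n : ℝ) ^ p + b - m n) / (n : ℝ) ^ p) atTop (𝓝 a) := by
  have h := (hm.add_const a).add (tendsto_const_div_nat_rpow hp b)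
  rw [zero_add, add_zero] at h
  refine h.congr' ?_
  filter_upwards [eventually_gt_atTop 0] with n hn
  have hn' : (0 : ℝ) < n := by exact_mod_cast hn
  field_simp
  ring

theorem tendsto_self_div :
    Tendsto (fun n : ℕ => (n : ℝ) / n) atTop (𝓝 1) := by
  refine tendsto_const_nhds.congr' ?_
  filter_upwards [eventually_gt_atTop 0] with n hn
  rw [div_self (by exact_mod_cast hn.ne')]

theorem eventually_setOf_le_scaledLog (hp' : p < 1) (a : ℝ) :
    ∀ᶠ n : ℕ in atTop, {x | a ≤ scaledLog p n x} =
      {x | Real.exp ((n : ℝ) + a * (n : ℝ) ^ p) ≤ partialQuotient n x} := by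
  have h := (tendsto_nat_rpow_zero (sub_neg.2 hp')).const_mul a
  rw [mul_zero] at h
  filter_upwards [eventually_gt_atTop 0, h.eventually_const_lt (by norm_num : (-1 : ℝ) < 0)]
    with n hn h1
  have hn' : (0 : ℝ) < n := by exact_mod_cast hn
  rw [Real.rpow_sub_one hn'.ne', ← mul_div_assoc, lt_div_iff₀ hn'] at h1
  ext x
  simp only [scaledLog, mem_ofPred_eq]
  rw [le_div_iff₀ (by positivity), le_sub_iff_add_le']
  -- A terminated expansion has digit `0` and `Real.log 0 = 0`; it is excluded from both sets
  -- because `n + a n ^ p > 0` for large `n`.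
  rcases Nat.eq_zero_or_pos (partialQuotient n x) with h0 | h0
  · simp only [h0, Nat.cast_zero, Real.log_zero]
    exact ⟨fun h => by linarith, fun h => absurd h (Real.exp_pos _).not_ge⟩
  · exact Real.le_log_iff_exp_le (by exact_mod_cast h0)

theorem eventually_real_scaledLog_lt (hp' : p < 1) (a : ℝ) :
    ∀ᶠ n : ℕ in atTop, lebesgueUnit.real {x | scaledLog p n x < -a} =
      1 - lebesgueUnit.real {x | Real.exp ((n : ℝ) + -a * (n : ℝ) ^ p) ≤ partialQuotient n x} := by
  filter_upwards [eventually_setOf_le_scaledLog hp' (-a)] with n hn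
  have hm : MeasurableSet {x | -a ≤ scaledLog p n x} := measurable_scaledLog p n measurableSet_Ici
  rw [← hn, ← probReal_compl_eq_one_sub hm]
  congr 1
  ext x
  simp

/-- The number of initial digits discarded in the lower bound for the partial quotients. -/
noncomputable def burnIn (p : ℝ) (n : ℕ) : ℕ := ⌊(n : ℝ) ^ ((3 * p - 1) / 2)⌋₊

theorem burnIn_mem (hp : 1 / 2 < p) (hp' : p < 1) {n : ℕ} (hn : 1 ≤ n) :
    1 ≤ burnIn p n ∧ burnIn p n ≤ n := by
  have hn' : (1 : ℝ) ≤ n := by exact_mod_cast hn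
  constructor
  · exact Nat.le_floor (by simpa using Real.one_le_rpow hn' (by linarith))
  · refine Nat.floor_le_of_le ?_
    simpa using Real.rpow_le_rpow_of_exponent_le hn' (by linarith : (3 * p - 1) / 2 ≤ 1)

theorem tendsto_burnIn_div {q : ℝ} (hq : (3 * p - 1) / 2 < q) :
    Tendsto (fun n : ℕ => (burnIn p n : ℝ) / (n : ℝ) ^ q) atTop (𝓝 0) := by
  refine squeeze_zero' (Eventually.of_forall fun n => by positivity) ?_
    (tendsto_nat_rpow_zero (sub_neg.2 hq))
  filter_upwards [eventually_gt_atTop 0] with n hn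
  have hn' : (0 : ℝ) < n := by exact_mod_cast hn
  rw [Real.rpow_sub hn']
  gcongr
  exact Nat.floor_le (by positivity)

theorem tendsto_sub_burnIn_div (hp : 1 / 2 < p) (hp' : p < 1) :
    Tendsto (fun n : ℕ => ((n - burnIn p n : ℕ) : ℝ) / n) atTop (𝓝 1) := by
  have h := (tendsto_burnIn_div (by linarith : (3 * p - 1) / 2 < 1)).const_sub 1
  rw [sub_zero] at h
  refine h.congr' ?_
  filter_upwards [eventually_gt_atTop 0] with n hn
  have hn' : (0 : ℝ) < n := by exact_mod_cast hn
  rw [Nat.cast_sub (burnIn_mem hp hp' hn).2, Real.rpow_one]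
  field_simp

theorem tendsto_burnIn_exponent (hp : 1 / 2 < p) (hp' : p < 1) (a : ℝ) :
    Tendsto (fun n : ℕ => ((n : ℝ) + a * (n : ℝ) ^ p + 1 - (n - burnIn p n : ℕ)) / (n : ℝ) ^ p)
      atTop (𝓝 a) := by
  refine tendsto_add_mul_rpow_sub_div (by linarith) a 1
    ((tendsto_burnIn_div (by linarith : (3 * p - 1) / 2 < p)).congr' ?_)
  filter_upwards [eventually_gt_atTop 0] with n hn
  rw [Nat.cast_sub (burnIn_mem hp hp' hn).2, sub_sub_cancel]

/-- The failure probability decays like `exp (-κ n ^ q)` up to lower-order terms, with `q > 2p - 1`,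
so it beats every rate `c`. -/
theorem eventually_one_sub_real_burnIn_le (hp : 1 / 2 < p) (hp' : p < 1) (c : ℝ) :
    ∀ᶠ n : ℕ in atTop, 1 - lebesgueUnit.real {x | n ≤ partialQuotient (burnIn p n) x} ≤
      Real.exp (-c * (n : ℝ) ^ (2 * p - 1)) := by
  have hκ : 0 < Real.log (3 / 2) - Real.log 2 / 2 := by
    have h : Real.log 2 < Real.log ((3 / 2) ^ 2) := Real.log_lt_log two_pos (by norm_num)
    rw [Real.log_pow] at h
    push_cast at h
    linarith
  set κ := Real.log (3 / 2) - Real.log 2 / 2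
  set q := (3 * p - 1) / 2 with hq
  have hq0 : 0 < q := by linarith
  have h1 := (tendsto_nat_rpow_zero (by linarith : 2 * p - 1 - q < 0)).const_mul c
  rw [mul_zero] at h1
  -- The target rate takes `κ/3` of the available `κ n ^ q`, the logarithmic term `κ/6`, and the two
  -- units lost to the floor and the index shift `κ/3`.
  filter_upwards [eventually_ge_atTop 2, h1.eventually_lt_const (by linarith : 0 < κ / 3),
    eventually_log_nat_le_rpow hq0 (by linarith : 0 < κ / 3),
    (tendsto_nat_rpow_atTop hq0).eventually_ge_atTop 6] with n hn h1 h2 h3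
  have hn' : (0 : ℝ) < n := by exact_mod_cast (by omega : 0 < n)
  obtain ⟨hM, -⟩ := burnIn_mem hp hp' (by omega : 1 ≤ n)
  have h4 := one_sub_real_partialQuotient_le hn (burnIn p n - 1)
  rw [Nat.add_sub_cancel' hM, Nat.cast_sub hM, Nat.cast_one,
    show Real.log (3 / 2) - Real.log 2 / 2 = κ from rfl] at h4
  refine h4.trans (Real.exp_le_exp.2 ?_)
  have h5 : (n : ℝ) ^ q - 1 < burnIn p n := Nat.sub_one_lt_floor _
  rw [Real.rpow_sub hn', ← mul_div_assoc, div_lt_iff₀ (by positivity)] at h1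
  have h6 := mul_le_mul_of_nonneg_right h5.le hκ.le
  have h7 := mul_le_mul_of_nonneg_right h3 hκ.le
  linarith

theorem mul_gammaTail_le_real_burnIn (hp : 1 / 2 < p) (hp' : p < 1) {n : ℕ} (hn : 1 ≤ n) (s : ℝ) :
    lebesgueUnit.real {x | n ≤ partialQuotient (burnIn p n) x} *
        gammaTail (n - burnIn p n) (Real.exp (s + 1)) ≤
      lebesgueUnit.real {x | Real.exp s ≤ partialQuotient n x} := by
  obtain ⟨h1, h2⟩ := burnIn_mem hp hp' hn
  have h := mul_gammaTail_le_real_partialQuotient h1 hn (Nat.sub_le n (burnIn p n)) s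
  rwa [Nat.add_sub_cancel' h2] at h

theorem eventually_real_scaledLog_ge_le (hp : 1 / 2 < p) (hp' : p < 1) (ha : 0 < a)
    (hc : c < a ^ 2 / 2) :
    ∀ᶠ n : ℕ in atTop, lebesgueUnit.real {x | a ≤ scaledLog p n x} ≤
      Real.exp (-c * (n : ℝ) ^ (2 * p - 1)) := by
  filter_upwards [eventually_ge_atTop 1, eventually_setOf_le_scaledLog hp' a,
    eventually_gammaTail_le hp' ha tendsto_self_div
      (tendsto_add_mul_rpow_sub_div (by linarith) a (-Real.log 2) (by simp)) hc] with n hn h1 h2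
  rw [h1]
  exact (real_exp_le_partialQuotient_le hn _).trans h2

theorem eventually_le_real_scaledLog_ge (hp : 1 / 2 < p) (hp' : p < 1)
    (hc : a ^ 2 / 2 < c) :
    ∀ᶠ n : ℕ in atTop, Real.exp (-c * (n : ℝ) ^ (2 * p - 1)) ≤
      lebesgueUnit.real {x | a ≤ scaledLog p n x} := by
  obtain ⟨d, hd1, hd2⟩ := exists_between hc
  have hs := tendsto_nat_rpow_atTop (by linarith : 0 < 2 * p - 1)
  filter_upwards [eventually_ge_atTop 1, eventually_setOf_le_scaledLog hp' a,
    eventually_le_gammaTail hp hp' (tendsto_sub_burnIn_div hp hp')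
      (tendsto_burnIn_exponent hp hp' a) hd1, eventually_one_sub_real_burnIn_le hp hp' 1,
    eventually_two_mul_exp_le hs hd2, eventually_two_mul_exp_le hs zero_lt_one]
    with n hn h1 h2 h3 h4 h5
  rw [h1]
  refine le_trans ?_ (mul_gammaTail_le_real_burnIn hp hp' hn _)
  -- Now `2 exp (-n ^ (2p - 1)) ≤ 1`, so level `n` is reached with probability at least `1/2`.
  rw [neg_zero, zero_mul, Real.exp_zero] at h5
  calc _ ≤ 1 / 2 * Real.exp (-d * (n : ℝ) ^ (2 * p - 1)) := by linarith
    _ ≤ _ := by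
      gcongr
      linarith

theorem eventually_real_scaledLog_lt_le (hp : 1 / 2 < p) (hp' : p < 1) (ha : 0 < a)
    (hc : c < a ^ 2 / 2) :
    ∀ᶠ n : ℕ in atTop, lebesgueUnit.real {x | scaledLog p n x < -a} ≤
      Real.exp (-c * (n : ℝ) ^ (2 * p - 1)) := by
  obtain ⟨d, hd1, hd2⟩ := exists_between hc
  have hs := tendsto_nat_rpow_atTop (by linarith : 0 < 2 * p - 1)
  filter_upwards [eventually_ge_atTop 1, eventually_real_scaledLog_lt hp' a,
    eventually_one_sub_gammaTail_le hp' (neg_neg_of_pos ha) (tendsto_sub_burnIn_div hp hp')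
      (tendsto_burnIn_exponent hp hp' (-a)) (by rwa [neg_sq] : d < (-a) ^ 2 / 2),
    eventually_one_sub_real_burnIn_le hp hp' d,
    eventually_two_mul_exp_le hs hd1] with n hn h1 h2 h3 h4
  rw [h1]
  have h5 := mul_gammaTail_le_real_burnIn hp hp' hn ((n : ℝ) + -a * (n : ℝ) ^ p)
  have h6 : lebesgueUnit.real {x | n ≤ partialQuotient (burnIn p n) x} ≤ 1 := measureReal_le_one
  have h7 := gammaTail_le_one (n - burnIn p n) (Real.exp ((n : ℝ) + -a * (n : ℝ) ^ p + 1))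
  -- For `P, G ≤ 1`, `1 - P G ≤ (1 - P) + (1 - G)`: either level `n` is missed or the Gamma sum is
  -- too small.
  nlinarith [mul_nonneg (sub_nonneg.2 h6) (sub_nonneg.2 h7)]

theorem eventually_le_real_scaledLog_lt (hp : 1 / 2 < p) (hp' : p < 1)
    (hc : a ^ 2 / 2 < c) :
    ∀ᶠ n : ℕ in atTop, Real.exp (-c * (n : ℝ) ^ (2 * p - 1)) ≤
      lebesgueUnit.real {x | scaledLog p n x < -a} := by
  filter_upwards [eventually_ge_atTop 1, eventually_real_scaledLog_lt hp' a,
    eventually_le_one_sub_gammaTail hp hp' tendsto_self_div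
      (tendsto_add_mul_rpow_sub_div (by linarith) (-a) (-Real.log 2) (by simp))
      (by rwa [neg_sq] : (-a) ^ 2 / 2 < c)] with n hn h1 h2
  rw [h1]
  exact h2.trans (sub_le_sub_left (real_exp_le_partialQuotient_le hn _) 1)

end

end EngelCF

theorem mainTheorem5 (p : ℝ) (hp : 1 / 2 < p) (hp' : p < 1) :
    EngelCF.SatisfiesLDP EngelCF.lebesgueUnit
      (fun (n : ℕ) (x : ℝ) =>
        (Real.log (EngelCF.partialQuotient n x : ℝ) - (n : ℝ)) / (n : ℝ) ^ p)
      (fun n : ℕ => (n : ℝ) ^ (2 * p - 1))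
      (fun x : ℝ => ENNReal.ofReal (x ^ 2 / 2)) :=
  EngelCF.satisfiesLDP_of_tails (fun n _ => EngelCF.measurable_scaledLog p n)
    (EngelCF.tendsto_nat_rpow_atTop (by linarith))
    (fun _ _ ha hc => EngelCF.eventually_real_scaledLog_ge_le hp hp' ha hc)
    (fun _ _ _ hc => EngelCF.eventually_le_real_scaledLog_ge hp hp' hc)
    (fun _ _ ha hc => EngelCF.eventually_real_scaledLog_lt_le hp hp' ha hc)
    (fun _ _ _ hc => EngelCF.eventually_le_real_scaledLog_lt hp hp' hc)
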